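/- For $n\ge 0$ let $\mathcal F_n$ be the set of real trigonometric polynomials $f(t)=\frac{a_0}{2}+\sum_{k=1}^{n}(a_k\cos kt+b_k\sin kt)$, $a_k,b_k\in\mathbb R$, and for a trigonometric polynomial $f$ let $\mu(f)$ be the Lebesgue measure of $\{t\in[0,2\pi]:|f(t)|\ge 1\}$. For $n\ge 1$ and real $y$ let $\mathcal F_n(y)=\{y\cos nt+g(t): g\in\mathcal F_{n-1}\}$ and $\sigma_n(y)=\inf\{\mu(f): f\in\mathcal F_n(y)\}$. Let $T_n$ be the Chebyshev polynomial of the first kind, $T_n(x)=\cos(n\arccos x)$ for $x\in[-1,1]$. Theorem. Let $n\ge 1$ be an integer and $y>1$. Then $$\sigma_n(y)=4\arccos\frac{1}{y^{1/(2n)}}.$$ Moreover, for each $k=0,1,\dots,2n-1$ the function $$f_{n,k}(t)=(-1)^kT_n\!\left(y^{1/n}\cos\left(t-\frac{\pi k}{n}\right)-y^{1/n}+1\right)$$ belongs to $\mathcal F_n(y)$ and is extremal, i.e. $\mu(f_{n,k})=\sigma_n(y)$; and every $f\in\mathcal F_n(y)$ with $\mu(f)=\sigma_n(y)$ is equal to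 $f_{n,k}$ for some $k\in\{0,1,\dots,2n-1\}$. -/

import Mathlib

open MeasureTheory

noncomputable section

/-- The set `𝓕ₙ` of real trigonometric polynomials
`f(t) = a₀ / 2 + ∑_{k=1}^{n} (aₖ cos kt + bₖ sin kt)` of order (at most) `n`. -/
def trigPoly (n : ℕ) : Set (ℝ → ℝ) :=
  {f | ∃ a b : ℕ → ℝ, ∀ t : ℝ,
    f t = a 0 / 2 + ∑ k ∈ Finset.Icc 1 n,
      (a k * Real.cos (k * t) + b k * Real.sin (k * t))}

/-- The set `𝓕ₙ(y)`, for `n ≥ 1`, of the polynomials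
`f(t) = y cos nt + g(t)` with `g ∈ 𝓕ₙ₋₁`. -/
def trigPolyLeading (n : ℕ) (y : ℝ) : Set (ℝ → ℝ) :=
  {f | ∃ g ∈ trigPoly (n - 1), ∀ t : ℝ, f t = y * Real.cos (n * t) + g t}

/-- The functional `μ(f) = mes {t ∈ 𝕋 : |f(t)| ≥ 1}`, with the torus realised as the
period `[0, 2π]` (the two end-points being one point does not matter for the measure). -/
def deviationMeasure (f : ℝ → ℝ) : ℝ :=
  volume.real {t : ℝ | t ∈ Set.Icc 0 (2 * Real.pi) ∧ 1 ≤ |f t|}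

/-- `σₙ(y) = inf {μ(f) : f ∈ 𝓕ₙ(y)}`; the set of values is non-empty and bounded below
by `0`. -/
def leastDeviation (n : ℕ) (y : ℝ) : ℝ :=
  sInf (deviationMeasure '' trigPolyLeading n y)

/-- `f` is extremal: it belongs to `𝓕ₙ(y)` and `μ(f) = σₙ(y)`. -/
def IsLeastDeviating (n : ℕ) (y : ℝ) (f : ℝ → ℝ) : Prop :=
  f ∈ trigPolyLeading n y ∧ deviationMeasure f = leastDeviation n y

/-- `fₙ,ₖ(t) = (-1)ᵏ Tₙ(y^{1/n} cos(t - πk/n) - y^{1/n} + 1)`. -/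
def extremalPoly (n : ℕ) (y : ℝ) (k : ℕ) : ℝ → ℝ := fun t =>
  (-1) ^ k * (Polynomial.Chebyshev.T ℝ (n : ℤ)).eval
    (y ^ (1 / (n : ℝ)) * Real.cos (t - Real.pi * k / n) - y ^ (1 / (n : ℝ)) + 1)

end

open Filter Topology ComplexConjugate

/-! Put `P(z) = z^n f`, a self-reciprocal polynomial of degree `2n` with `P(0) = y/2`. Let `A` be a
compact set on which `|f| ≤ 1`, `m < 2π` its measure, and `E` its image on the unit circle. The
larger root `X` of `X² - 2PX + z^(2n)` is `z^n` times the inverse Joukowski image of `P/z^n`, so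
`|X| = 1` on `E`, while `X = y` at the origin and `|X|` grows like `|z|^(2n)` at infinity. It is
compared with a function `B = discMap A`, analytic off `E`, bounded by 1, vanishing at infinity,
with `|B(0)| = sin(m/4)`. It is built from the harmonic measure of `A`: `w = exp(iπH/2)`, with `H`
the Herglotz transform, lies in the right half-plane, and a Möbius map sends that half-plane to the
disc.

The function `|X| |B|^(2n)` obeys the strong maximum principle off `E` and is at most `|X|`, hence
it is at most 1. At the origin this reads `y sin(m/4)^(2n) ≤ 1`, which bounds `m` above and the
deviation below. Infinity never enters: under `z ↦ 1/conj z` the function is multiplied by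
`(|S(z)|/|z|)^(2n)`, with `S = schwarzMap A` fixing 0 and mapping the disc into itself, so by the
Schwarz lemma a maximum over the closed disc is a local maximum in the plane (`comparison_le_one`).

If equality holds, the function is constant near a circle point off `E`, so `S` is a rotation and `X
B^(2n)` is constant. Then `ψ = S B²` satisfies `2P = z^n (c ψ^(-n) + c ψ^n)` with `c = ±1`, and `(ψ
+ 1/ψ)/2` is an affine function of a shifted cosine; this is the Chebyshev form of `f`
(`exists_eq_chebyshev_of_comparison_eq_one`). Conversely, for `fₙ,ₖ` the Chebyshev argument lies in
`[-1,1]` off an arc of exactly the required length. -/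

/-! ### The larger root of a quadratic and a maximum principle for its modulus -/

/-- The modulus of the larger root of `X ^ 2 - 2 p X + q ^ 2`. -/
noncomputable def joukowskiModulus (p q : ℂ) : ℝ :=
  (‖p - q‖ + ‖p + q‖ + √((‖p - q‖ + ‖p + q‖) ^ 2 - 4 * ‖q‖ ^ 2)) / 2

lemma two_mul_norm_le_norm_sub_add_norm_add (p q : ℂ) : 2 * ‖q‖ ≤ ‖p - q‖ + ‖p + q‖ := by
  have h : ‖(p + q) - (p - q)‖ ≤ ‖p + q‖ + ‖p - q‖ := norm_sub_le _ _
  have h2 : (p + q) - (p - q) = 2 * q := by ring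
  rw [h2, norm_mul] at h
  simp only [Complex.norm_ofNat] at h
  linarith

lemma norm_le_joukowskiModulus (p q : ℂ) : ‖q‖ ≤ joukowskiModulus p q := by
  have := two_mul_norm_le_norm_sub_add_norm_add p q
  have := Real.sqrt_nonneg ((‖p - q‖ + ‖p + q‖) ^ 2 - 4 * ‖q‖ ^ 2)
  unfold joukowskiModulus
  linarith

lemma joukowskiModulus_nonneg (p q : ℂ) : 0 ≤ joukowskiModulus p q :=
  (norm_nonneg q).trans (norm_le_joukowskiModulus p q)

lemma joukowskiModulus_eq_norm_of_eq {p q : ℂ} (h : ‖p - q‖ + ‖p + q‖ = 2 * ‖q‖) :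
    joukowskiModulus p q = ‖q‖ := by
  unfold joukowskiModulus
  rw [h, show (2 * ‖q‖) ^ 2 - 4 * ‖q‖ ^ 2 = 0 by ring]
  simp

/-- Unlike the root itself, its modulus needs no choice of branch, so it is continuous everywhere,
including across `p/q ∈ [-1,1]`. -/
lemma continuous_joukowskiModulus : Continuous fun x : ℂ × ℂ => joukowskiModulus x.1 x.2 := by
  unfold joukowskiModulus
  fun_prop

lemma joukowskiModulus_zero_right (p : ℂ) : joukowskiModulus p 0 = 2 * ‖p‖ := by
  unfold joukowskiModulus
  simp only [sub_zero, add_zero, norm_zero]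
  rw [show (‖p‖ + ‖p‖) ^ 2 - 4 * 0 ^ 2 = (‖p‖ + ‖p‖) ^ 2 by ring, Real.sqrt_sq (by positivity)]
  ring

lemma joukowskiModulus_conj (p q : ℂ) :
    joukowskiModulus (conj p) (conj q) = joukowskiModulus p q := by
  unfold joukowskiModulus
  rw [← map_sub, ← map_add]
  simp only [Complex.norm_conj]

lemma joukowskiModulus_mul (a p q : ℂ) :
    joukowskiModulus (a * p) (a * q) = ‖a‖ * joukowskiModulus p q := by
  unfold joukowskiModulus
  rw [← mul_sub, ← mul_add]
  simp only [norm_mul]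
  rw [show (‖a‖ * ‖p - q‖ + ‖a‖ * ‖p + q‖) ^ 2 - 4 * (‖a‖ * ‖q‖) ^ 2
    = ‖a‖ ^ 2 * ((‖p - q‖ + ‖p + q‖) ^ 2 - 4 * ‖q‖ ^ 2) by ring,
    Real.sqrt_mul (by positivity), Real.sqrt_sq (norm_nonneg a)]
  ring

lemma joukowskiModulus_real_mul {q : ℂ} {r : ℝ} (hr : |r| ≤ 1) :
    joukowskiModulus (r * q) q = ‖q‖ := by
  apply joukowskiModulus_eq_norm_of_eq
  obtain ⟨h1, h2⟩ := abs_le.1 hr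
  have e1 : ‖(r : ℂ) * q - q‖ = (1 - r) * ‖q‖ := by
    rw [show (r : ℂ) * q - q = ((r - 1 : ℝ) : ℂ) * q by push_cast; ring, norm_mul,
      Complex.norm_real, Real.norm_eq_abs, abs_of_nonpos (by linarith)]
    ring
  have e2 : ‖(r : ℂ) * q + q‖ = (1 + r) * ‖q‖ := by
    rw [show (r : ℂ) * q + q = ((1 + r : ℝ) : ℂ) * q by push_cast; ring, norm_mul,
      Complex.norm_real, Real.norm_eq_abs, abs_of_nonneg (by linarith)]
  rw [e1, e2]
  ring

/-- `joukowskiModulus p q` is the modulus of any root that is not the smaller one. -/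
lemma joukowskiModulus_eq_norm_root {p q x : ℂ} (hx : x ^ 2 - 2 * p * x + q ^ 2 = 0)
    (hqx : ‖q‖ ≤ ‖x‖) (hx0 : x ≠ 0) : joukowskiModulus p q = ‖x‖ := by
  have hn : 0 < ‖x‖ := norm_pos_iff.2 hx0
  have e1 : p - q = (x - q) ^ 2 / (2 * x) := by
    field_simp
    linear_combination -hx
  have e2 : p + q = (x + q) ^ 2 / (2 * x) := by
    field_simp
    linear_combination -hx
  have par := parallelogram_law_with_norm ℝ x q
  have hS : ‖p - q‖ + ‖p + q‖ = ‖x‖ + ‖q‖ ^ 2 / ‖x‖ := by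
    rw [e1, e2]
    simp only [norm_div, norm_pow, norm_mul, Complex.norm_ofNat]
    field_simp
    nlinarith [par]
  have hle : ‖q‖ ^ 2 / ‖x‖ ≤ ‖x‖ := by
    rw [div_le_iff₀ hn]
    nlinarith [norm_nonneg q]
  unfold joukowskiModulus
  rw [hS, show (‖x‖ + ‖q‖ ^ 2 / ‖x‖) ^ 2 - 4 * ‖q‖ ^ 2 = (‖x‖ - ‖q‖ ^ 2 / ‖x‖) ^ 2 by
    field_simp; ring, Real.sqrt_sq (by linarith)]
  ring

/-- The larger root of `X ^ 2 - 2 p X + q ^ 2`, valid when `p / q` is outside `[-1, 1]`. -/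
noncomputable def joukowskiRoot (p q : ℂ) : ℂ := p * (1 + (1 - (q / p) ^ 2) ^ (1 / 2 : ℂ))

/-- Otherwise `p = 0` or `(q/p)²` is real and at least 1. Either way `p` is a real multiple of `q`
with factor in `[-1,1]`, where both roots have modulus `‖q‖`. -/
lemma ne_zero_and_mem_slitPlane_of_lt {p q : ℂ} (h : ‖q‖ < joukowskiModulus p q) :
    p ≠ 0 ∧ 1 - (q / p) ^ 2 ∈ Complex.slitPlane := by
  have hp : p ≠ 0 := by
    rintro rfl
    have := joukowskiModulus_real_mul (q := q) (r := 0) (by simp)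
    simp only [Complex.ofReal_zero, zero_mul] at this
    linarith
  refine ⟨hp, ?_⟩
  by_contra hs
  rw [Complex.mem_slitPlane_iff] at hs
  push Not at hs
  obtain ⟨hre, him⟩ := hs
  set u := q / p with hu
  have hq : q = u * p := by rw [hu]; field_simp
  have hre' : 1 ≤ (u ^ 2).re := by simpa using hre
  have him' : (u ^ 2).im = 0 := by simpa using him
  rw [sq, Complex.mul_re] at hre'
  rw [sq, Complex.mul_im] at him'
  have hui : u.im = 0 := by
    by_contra hne
    have : u.re = 0 := by
      have : u.re * u.im = 0 := by linarith
      exact (mul_eq_zero.1 this).resolve_right hne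
    nlinarith [sq_nonneg u.im]
  have hur : u = (u.re : ℂ) := Complex.ext (by simp) (by simp [hui])
  have hu1 : 1 ≤ u.re ^ 2 := by rw [hui] at hre'; nlinarith
  have hu0 : u.re ≠ 0 := by intro h0; rw [h0] at hu1; norm_num at hu1
  have hp' : p = ((u.re⁻¹ : ℝ) : ℂ) * q := by
    rw [hq, hur]
    have : (u.re : ℂ) ≠ 0 := by exact_mod_cast hu0
    push_cast
    field_simp
    simp only [Complex.ofReal_re]
    exact (div_self this).symm
  have hinv : |u.re⁻¹| ≤ 1 := by
    rw [abs_inv]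
    apply inv_le_one_of_one_le₀
    rw [← sq_abs] at hu1
    nlinarith [abs_nonneg u.re]
  have := joukowskiModulus_real_mul (q := q) hinv
  rw [← hp'] at this
  linarith

lemma re_cpow_half_nonneg (z : ℂ) : 0 ≤ (z ^ (1 / 2 : ℂ)).re := by
  by_cases hz : z = 0
  · simp [hz]
  rw [Complex.cpow_def_of_ne_zero hz, Complex.exp_re]
  apply mul_nonneg (Real.exp_pos _).le
  have h1 : (Complex.log z * (1 / 2 : ℂ)).im = z.arg / 2 := by
    rw [show (1 / 2 : ℂ) = ((1 / 2 : ℝ) : ℂ) by push_cast; ring, Complex.im_mul_ofReal,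
      Complex.log_im]
    ring
  rw [h1]
  apply Real.cos_nonneg_of_mem_Icc
  constructor <;> linarith [Complex.neg_pi_lt_arg z, Complex.arg_le_pi z]

lemma joukowskiRoot_eqn {p q : ℂ} (hp : p ≠ 0) :
    joukowskiRoot p q ^ 2 - 2 * p * joukowskiRoot p q + q ^ 2 = 0 := by
  unfold joukowskiRoot
  have hs : ((1 - (q / p) ^ 2) ^ (1 / 2 : ℂ)) ^ 2 = 1 - (q / p) ^ 2 := by
    simp
  have e : q ^ 2 = p ^ 2 * (q / p) ^ 2 := by field_simp
  rw [e]
  linear_combination p ^ 2 * hs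

/-- The two roots are `p(1 ± s)` with `s` the principal square root; `0 ≤ Re s` gives `|1 - s| ≤ |1
+ s|`, so the plus sign selects the larger. -/
lemma norm_joukowskiRoot {p q : ℂ} (hp : p ≠ 0) :
    joukowskiRoot p q ≠ 0 ∧ ‖joukowskiRoot p q‖ = joukowskiModulus p q := by
  have heq := joukowskiRoot_eqn (q := q) hp
  set s := (1 - (q / p) ^ 2) ^ (1 / 2 : ℂ) with hs
  have hre : 0 ≤ s.re := re_cpow_half_nonneg _
  have hX : joukowskiRoot p q = p * (1 + s) := rfl
  have h0 : joukowskiRoot p q ≠ 0 := by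
    rw [hX]
    refine mul_ne_zero hp fun h => ?_
    have := congrArg Complex.re h
    simp at this
    linarith
  have hle : ‖1 - s‖ ≤ ‖1 + s‖ := by
    apply (sq_le_sq₀ (norm_nonneg _) (norm_nonneg _)).1
    rw [← Complex.normSq_eq_norm_sq, ← Complex.normSq_eq_norm_sq, Complex.normSq_apply,
      Complex.normSq_apply]
    simp
    nlinarith
  have hq2 : q ^ 2 = joukowskiRoot p q * (p * (1 - s)) := by
    rw [hX] at heq ⊢
    linear_combination heq
  refine ⟨h0, (joukowskiModulus_eq_norm_root heq ?_ h0).symm⟩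
  apply (sq_le_sq₀ (norm_nonneg _) (norm_nonneg _)).1
  rw [← norm_pow, hq2, hX, norm_mul, norm_mul, norm_mul, sq]
  gcongr

lemma DifferentiableAt.joukowskiRoot {P Q : ℂ → ℂ} {c : ℂ} (hP : DifferentiableAt ℂ P c)
    (hQ : DifferentiableAt ℂ Q c) (hc : ‖Q c‖ < joukowskiModulus (P c) (Q c)) :
    DifferentiableAt ℂ (fun z => joukowskiRoot (P z) (Q z)) c := by
  obtain ⟨hp, hs⟩ := ne_zero_and_mem_slitPlane_of_lt hc
  unfold _root_.joukowskiRoot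
  refine hP.mul ((differentiableAt_const _).add ?_)
  exact DifferentiableAt.cpow ((differentiableAt_const _).sub ((hQ.div hP hp).pow 2))
    (differentiableAt_const _) hs

/-- Strong maximum principle for `joukowskiModulus P Q * ‖B‖`. -/
theorem eventually_eq_of_isLocalMax_joukowskiModulus {P Q B : ℂ → ℂ} {c : ℂ}
    (hP : Differentiable ℂ P) (hQ : Differentiable ℂ Q)
    (hB : ∀ᶠ z in 𝓝 c, DifferentiableAt ℂ B z)
    (hmax : IsLocalMax (fun z => joukowskiModulus (P z) (Q z) * ‖B z‖) c) :
    ∀ᶠ z in 𝓝 c, joukowskiModulus (P z) (Q z) * ‖B z‖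
      = joukowskiModulus (P c) (Q c) * ‖B c‖ := by
  have hKcont : Continuous fun z => joukowskiModulus (P z) (Q z) :=
    continuous_joukowskiModulus.comp (hP.continuous.prodMk hQ.continuous)
  have hnn : ∀ z, 0 ≤ joukowskiModulus (P z) (Q z) * ‖B z‖ := fun z =>
    mul_nonneg (joukowskiModulus_nonneg _ _) (norm_nonneg _)
  rcases eq_or_lt_of_le (hnn c) with h0 | hpos
  · filter_upwards [hmax] with z hz
    exact le_antisymm hz (by rw [← h0]; exact hnn z)
  have hBc : B c ≠ 0 := by
    intro h
    simp [h] at hpos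
  have hBne : ∀ᶠ z in 𝓝 c, B z ≠ 0 :=
    hB.self_of_nhds.continuousAt.eventually_ne hBc
  rcases eq_or_lt_of_le (norm_le_joukowskiModulus (P c) (Q c)) with he | hlt
  -- On the branch cut at `c`: `‖Q B‖` lies below the function and touches it at `c`, so it too has
  -- a local maximum there, is locally constant, and squeezes the function.
  · have hm : IsLocalMax (norm ∘ fun z => Q z * B z) c := by
      filter_upwards [hmax] with z hz
      simp only [Function.comp, norm_mul]
      rw [he]
      refine le_trans ?_ hz
      exact mul_le_mul_of_nonneg_right (norm_le_joukowskiModulus _ _) (norm_nonneg _)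
    have hd : ∀ᶠ z in 𝓝 c, DifferentiableAt ℂ (fun z => Q z * B z) z := by
      filter_upwards [hB] with z hz using (hQ z).mul hz
    filter_upwards [Complex.norm_eventually_eq_of_isLocalMax hd hm, hmax, hBne] with z h1 h2 h3
    simp only [norm_mul] at h1
    rw [he] at h1
    refine le_antisymm h2 ?_
    rw [← h1]
    exact mul_le_mul_of_nonneg_right (norm_le_joukowskiModulus _ _) (norm_nonneg _)
  -- Off the cut the function is the modulus of an analytic function near `c`.
  · have hnear : ∀ᶠ z in 𝓝 c, ‖Q z‖ < joukowskiModulus (P z) (Q z) :=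
      hQ.continuous.norm.continuousAt.eventually_lt hKcont.continuousAt hlt
    have hd : ∀ᶠ z in 𝓝 c, DifferentiableAt ℂ (fun z => joukowskiRoot (P z) (Q z) * B z) z := by
      filter_upwards [hB, hnear] with z hz h2
      exact ((hP z).joukowskiRoot (hQ z) h2).mul hz
    have hnorm : ∀ᶠ z in 𝓝 c, ‖joukowskiRoot (P z) (Q z) * B z‖
        = joukowskiModulus (P z) (Q z) * ‖B z‖ := by
      filter_upwards [hnear] with z hz
      rw [norm_mul, (norm_joukowskiRoot (ne_zero_and_mem_slitPlane_of_lt hz).1).2]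
    have hm : IsLocalMax (norm ∘ fun z => joukowskiRoot (P z) (Q z) * B z) c := by
      filter_upwards [hmax, hnorm] with z h1 h2
      simp only [Function.comp]
      rw [h2, hnorm.self_of_nhds]
      exact h1
    filter_upwards [Complex.norm_eventually_eq_of_isLocalMax hd hm, hnorm] with z h1 h2
    rw [← h2, h1, hnorm.self_of_nhds]

/-! ### The Herglotz transform of a compact subset of the circle -/

/-- The subset of the unit circle with arguments in `A`. -/
def circleSet (A : Set ℝ) : Set ℂ := (fun t : ℝ => Complex.exp (t * Complex.I)) '' A

lemma exp_mem_circleSet {A : Set ℝ} {t : ℝ} (ht : t ∈ A) :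
    Complex.exp (t * Complex.I) ∈ circleSet A := ⟨t, ht, rfl⟩

lemma norm_of_mem_circleSet {A : Set ℝ} {z : ℂ} (hz : z ∈ circleSet A) : ‖z‖ = 1 := by
  obtain ⟨t, -, rfl⟩ := hz
  exact Complex.norm_exp_ofReal_mul_I t

lemma isCompact_circleSet {A : Set ℝ} (hA : IsCompact A) : IsCompact (circleSet A) :=
  hA.image (by fun_prop)

lemma notMem_circleSet_of_norm_ne {A : Set ℝ} {z : ℂ} (hz : ‖z‖ ≠ 1) : z ∉ circleSet A :=
  fun h => hz (norm_of_mem_circleSet h)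

lemma exp_sub_ne_zero {A : Set ℝ} {z : ℂ} (hz : z ∉ circleSet A) {t : ℝ} (ht : t ∈ A) :
    Complex.exp (t * Complex.I) - z ≠ 0 := by
  intro h
  exact hz (sub_eq_zero.1 h ▸ exp_mem_circleSet ht)

/-- The Herglotz transform of the normalised arc length on `circleSet A`. -/
noncomputable def herglotz (A : Set ℝ) (z : ℂ) : ℂ :=
  (2 * Real.pi)⁻¹ * ∫ t in A,
    (Complex.exp (t * Complex.I) + z) / (Complex.exp (t * Complex.I) - z)

section
variable {A : Set ℝ}

lemma continuousOn_herglotz_integrand {z : ℂ} (hz : z ∉ circleSet A) :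
    ContinuousOn (fun t : ℝ =>
      (Complex.exp (t * Complex.I) + z) / (Complex.exp (t * Complex.I) - z)) A := by
  apply ContinuousOn.div (by fun_prop) (by fun_prop)
  exact fun t ht => exp_sub_ne_zero hz ht

lemma integrableOn_herglotz_integrand (hA : IsCompact A) {z : ℂ} (hz : z ∉ circleSet A) :
    IntegrableOn (fun t : ℝ =>
      (Complex.exp (t * Complex.I) + z) / (Complex.exp (t * Complex.I) - z)) A :=
  (continuousOn_herglotz_integrand hz).integrableOn_compact hA

lemma differentiableAt_herglotz (hA : IsCompact A) {c : ℂ} (hc : c ∉ circleSet A) :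
    DifferentiableAt ℂ (herglotz A) c := by
  -- The doubled radius keeps every point of the `ε`-ball at distance at least `ε` from the circle
  -- set, which gives the dominating constant `2/ε²`.
  obtain ⟨ε, hε, hball⟩ : ∃ ε > 0, Metric.ball c (2 * ε) ⊆ (circleSet A)ᶜ := by
    obtain ⟨ε, hε, h⟩ := Metric.isOpen_iff.1 (isCompact_circleSet hA).isClosed.isOpen_compl c hc
    exact ⟨ε / 2, by positivity, by rwa [mul_div_cancel₀ ε two_ne_zero]⟩
  have hsub : Metric.ball c ε ⊆ (circleSet A)ᶜ :=
    (Metric.ball_subset_ball (by linarith)).trans hball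
  have hlow : ∀ z ∈ Metric.ball c ε, ∀ t ∈ A, ε ≤ ‖Complex.exp (t * Complex.I) - z‖ := by
    intro z hz t ht
    by_contra hlt
    push Not at hlt
    have : Complex.exp (t * Complex.I) ∈ Metric.ball c (2 * ε) := by
      rw [Metric.mem_ball] at hz ⊢
      calc dist (Complex.exp (t * Complex.I)) c
          ≤ dist (Complex.exp (t * Complex.I)) z + dist z c := dist_triangle _ _ _
        _ < 2 * ε := by rw [dist_eq_norm (Complex.exp _)]; linarith
    exact hball this (exp_mem_circleSet ht)
  have hmeas := hA.measurableSet
  have key := hasDerivAt_integral_of_dominated_loc_of_deriv_le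
    (μ := volume.restrict A) (𝕜 := ℂ)
    (F := fun (z : ℂ) (t : ℝ) =>
      (Complex.exp (t * Complex.I) + z) / (Complex.exp (t * Complex.I) - z))
    (F' := fun (z : ℂ) (t : ℝ) =>
      2 * Complex.exp (t * Complex.I) / (Complex.exp (t * Complex.I) - z) ^ 2)
    (x₀ := c) (s := Metric.ball c ε) (bound := fun _ => 2 / ε ^ 2)
    (Metric.ball_mem_nhds c hε) ?_ (integrableOn_herglotz_integrand hA hc) ?_ ?_ ?_ ?_
  · exact (key.2.differentiableAt).const_mul _
  · filter_upwards [Metric.ball_mem_nhds c hε] with z hz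
    exact (continuousOn_herglotz_integrand (hsub hz)).aestronglyMeasurable hmeas
  · refine ContinuousOn.aestronglyMeasurable ?_ hmeas
    apply ContinuousOn.div (by fun_prop) (by fun_prop)
    exact fun t ht => pow_ne_zero _ (exp_sub_ne_zero hc ht)
  · filter_upwards [ae_restrict_mem hmeas] with t ht z hz
    rw [norm_div, norm_mul, norm_pow, Complex.norm_exp_ofReal_mul_I, Complex.norm_ofNat, mul_one]
    have := hlow z hz t ht
    gcongr
  · exact integrable_const_iff.2 (Or.inr ⟨by simpa using hA.measure_lt_top⟩)
  · filter_upwards [ae_restrict_mem hmeas] with t ht z hz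
    have hne := exp_sub_ne_zero (hsub hz) ht
    have h1 := (((hasDerivAt_id z).const_add (Complex.exp (t * Complex.I))).div
      ((hasDerivAt_id z).const_sub (Complex.exp (t * Complex.I))) hne)
    refine h1.congr_deriv ?_
    simp only [id]
    congr 1
    ring

lemma herglotz_zero : herglotz A 0 = ((volume.real A / (2 * Real.pi) : ℝ) : ℂ) := by
  unfold herglotz
  simp only [add_zero, sub_zero, div_self (Complex.exp_ne_zero _)]
  rw [setIntegral_const]
  push_cast
  simp
  ring

/-- On the circle `conj u = u⁻¹`, so reflecting `z` turns the kernel `(u + z)/(u - z)` into minus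
its conjugate, pointwise in `t`. -/
lemma herglotz_one_div_conj {z : ℂ} (hz : z ≠ 0) :
    herglotz A (1 / conj z) = -conj (herglotz A z) := by
  unfold herglotz
  rw [map_mul, ← integral_conj, ← mul_neg, ← integral_neg]
  congr 1
  · exact (Complex.conj_ofReal _).symm
  refine integral_congr_ae (Eventually.of_forall fun t => ?_)
  simp only [map_div₀, map_add, map_sub]
  have hcz : conj z ≠ 0 := by simpa using hz
  have he : conj (Complex.exp (t * Complex.I)) = (Complex.exp (t * Complex.I))⁻¹ := by
    rw [← Complex.exp_conj, ← Complex.exp_neg]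
    simp
  rw [he]
  set u := Complex.exp (t * Complex.I) with hu
  have hu0 : u ≠ 0 := Complex.exp_ne_zero _
  have e1 : u + 1 / conj z = u / conj z * (u⁻¹ + conj z) := by field_simp; ring
  have e2 : u - 1 / conj z = -(u / conj z * (u⁻¹ - conj z)) := by field_simp; ring
  have h0 : u / conj z ≠ 0 := div_ne_zero hu0 hcz
  rw [e1, e2, div_neg, mul_div_mul_left _ _ h0]

lemma re_herglotz (hA : IsCompact A) {z : ℂ} (hz : z ∉ circleSet A) :
    (herglotz A z).re = (2 * Real.pi)⁻¹ * ∫ t in A,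
      ((Complex.exp (t * Complex.I) + z) / (Complex.exp (t * Complex.I) - z)).re := by
  unfold herglotz
  rw [Complex.re_ofReal_mul]
  congr 1
  exact (integral_re (integrableOn_herglotz_integrand hA hz)).symm

lemma re_herglotz_integrand_nonneg {z : ℂ} (hz : ‖z‖ < 1) (t : ℝ) :
    0 ≤ ((Complex.exp (t * Complex.I) + z) / (Complex.exp (t * Complex.I) - z)).re := by
  have h := le_re_herglotzRieszKernel (c := 0) (R := 1) (w := z)
    (z := Complex.exp (t * Complex.I)) (by simp [Complex.norm_exp_ofReal_mul_I]) (by simpa using hz)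
  simp only [sub_zero] at h
  refine le_trans ?_ h
  have := norm_nonneg z
  exact div_nonneg (by linarith) (by linarith)

lemma integral_re_herglotz_integrand {z : ℂ} (hz : ‖z‖ < 1) :
    ∫ t in Set.Icc 0 (2 * Real.pi),
      ((Complex.exp (t * Complex.I) + z) / (Complex.exp (t * Complex.I) - z)).re
      = 2 * Real.pi := by
  have h := DiffContOnCl.circleAverage_re_herglotzRieszKernel_smul' (c := 0) (R := 1) (w := z)
    (f := fun _ => (1 : ℂ)) diffContOnCl_const (by simpa using hz)
  unfold Real.circleAverage at h
  simp only [sub_zero, circleMap_zero, Complex.ofReal_one, one_mul, Complex.real_smul,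
    mul_one] at h
  rw [intervalIntegral.integral_ofReal, ← Complex.ofReal_mul, Complex.ofReal_eq_one,
    intervalIntegral.integral_of_le (by positivity), inv_mul_eq_one₀ (by positivity)] at h
  rw [integral_Icc_eq_integral_Ioc]
  exact h.symm

/-- In the disc the real part is the harmonic measure of `A`: the kernel is the Poisson kernel,
nonnegative and of mean one. -/
lemma re_herglotz_mem_Icc (hA : IsCompact A) (hAsub : A ⊆ Set.Icc 0 (2 * Real.pi)) {z : ℂ}
    (hz : ‖z‖ < 1) : 0 ≤ (herglotz A z).re ∧ (herglotz A z).re ≤ 1 := by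
  rw [re_herglotz hA (notMem_circleSet_of_norm_ne hz.ne)]
  have hpi := Real.pi_pos
  constructor
  · exact mul_nonneg (by positivity) (integral_nonneg fun t => re_herglotz_integrand_nonneg hz t)
  · rw [inv_mul_le_iff₀ (by positivity), mul_one]
    conv_rhs => rw [← integral_re_herglotz_integrand hz]
    refine setIntegral_mono_set ?_ ?_ hAsub.eventuallyLE
    · have := integrableOn_herglotz_integrand (A := Set.Icc 0 (2 * Real.pi)) isCompact_Icc
        (notMem_circleSet_of_norm_ne hz.ne)
      exact this.re
    · exact Eventually.of_forall fun t => re_herglotz_integrand_nonneg hz t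

/-- The reflection fixes the circle and negates the real part. On `circleSet A` itself this concerns
only the values assigned there by convention. -/
lemma re_herglotz_eq_zero_of_norm_eq_one {z : ℂ} (hz : ‖z‖ = 1) :
    (herglotz A z).re = 0 := by
  have h0 : z ≠ 0 := by rintro rfl; simp at hz
  have h := herglotz_one_div_conj (A := A) h0
  have e : 1 / conj z = z := by
    rw [div_eq_iff (by simpa using h0), Complex.mul_conj, Complex.normSq_eq_norm_sq, hz]
    simp
  rw [e] at h
  have := congrArg Complex.re h
  simp at this
  linarith

lemma abs_re_herglotz_le (hA : IsCompact A) (hAsub : A ⊆ Set.Icc 0 (2 * Real.pi)) (z : ℂ) :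
    |(herglotz A z).re| ≤ 1 := by
  rcases lt_trichotomy ‖z‖ 1 with h | h | h
  · obtain ⟨h1, h2⟩ := re_herglotz_mem_Icc hA hAsub h
    rw [abs_le]
    constructor <;> linarith
  · rw [re_herglotz_eq_zero_of_norm_eq_one h]
    simp
  · have h0 : z ≠ 0 := by rintro rfl; simp at h; linarith
    have hlt : ‖1 / conj z‖ < 1 := by
      rw [norm_div, norm_one, Complex.norm_conj, div_lt_one (by positivity)]
      exact h
    have h3 := re_herglotz_mem_Icc hA hAsub hlt
    rw [herglotz_one_div_conj h0] at h3
    simp at h3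
    rw [abs_le]
    constructor <;> linarith

end

/-! ### Bounded analytic functions off the circle set -/

/-- `conj b` and `-b` are mirror images in the imaginary axis, and `a` is on the side of `conj b`.
This is what bounds `discMap` by 1. -/
lemma norm_sub_conj_le_norm_add {a b : ℂ} (ha : 0 ≤ a.re) (hb : 0 ≤ b.re) :
    ‖a - conj b‖ ≤ ‖a + b‖ := by
  apply (sq_le_sq₀ (norm_nonneg _) (norm_nonneg _)).1
  rw [← Complex.normSq_eq_norm_sq, ← Complex.normSq_eq_norm_sq, Complex.normSq_apply,
    Complex.normSq_apply]
  simp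
  nlinarith [mul_nonneg ha hb]

/-- The same reflection argument in the real axis; it bounds `schwarzMap` by 1. -/
lemma norm_sub_le_norm_sub_conj {a b : ℂ} (ha : 0 ≤ a.im) (hb : 0 ≤ b.im) :
    ‖a - b‖ ≤ ‖a - conj b‖ := by
  apply (sq_le_sq₀ (norm_nonneg _) (norm_nonneg _)).1
  rw [← Complex.normSq_eq_norm_sq, ← Complex.normSq_eq_norm_sq, Complex.normSq_apply,
    Complex.normSq_apply]
  simp
  nlinarith [mul_nonneg ha hb]

/-- The analytic function off `circleSet A` whose values lie in the right half-plane and whose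
argument is `π / 2` times the real part of the Herglotz transform. -/
noncomputable def herglotzRoot (A : Set ℝ) (z : ℂ) : ℂ :=
  Complex.exp ((Real.pi / 2 : ℝ) * Complex.I * herglotz A z)

/-- The value of `herglotzRoot A` at the origin. -/
noncomputable def herglotzBase (A : Set ℝ) : ℂ :=
  Complex.exp ((volume.real A / 4 : ℝ) * Complex.I)

/-- A function off `circleSet A` with values in the unit disc that vanishes at infinity. -/
noncomputable def discMap (A : Set ℝ) (z : ℂ) : ℂ :=
  (herglotzRoot A z - conj (herglotzBase A)) / (herglotzRoot A z + herglotzBase A)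

section
variable {A : Set ℝ}

lemma herglotzRoot_zero : herglotzRoot A 0 = herglotzBase A := by
  unfold herglotzRoot herglotzBase
  rw [herglotz_zero]
  congr 1
  have : (Real.pi : ℂ) ≠ 0 := by exact_mod_cast Real.pi_ne_zero
  push_cast
  field_simp
  ring

lemma herglotzRoot_re_im (z : ℂ) : (herglotzRoot A z).re
      = Real.exp (-(Real.pi / 2 * (herglotz A z).im)) * Real.cos (Real.pi / 2 * (herglotz A z).re) ∧
    (herglotzRoot A z).im
      = Real.exp (-(Real.pi / 2 * (herglotz A z).im))
        * Real.sin (Real.pi / 2 * (herglotz A z).re) := by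
  have e1 : (((Real.pi / 2 : ℝ) : ℂ) * Complex.I * herglotz A z).re
      = -(Real.pi / 2 * (herglotz A z).im) := by
    rw [mul_assoc, Complex.re_ofReal_mul]; simp
  have e2 : (((Real.pi / 2 : ℝ) : ℂ) * Complex.I * herglotz A z).im
      = Real.pi / 2 * (herglotz A z).re := by
    rw [mul_assoc, Complex.im_ofReal_mul]; simp
  unfold herglotzRoot
  rw [Complex.exp_re, Complex.exp_im, e1, e2]
  exact ⟨rfl, rfl⟩

lemma herglotzRoot_re_nonneg (hA : IsCompact A) (hAsub : A ⊆ Set.Icc 0 (2 * Real.pi)) (z : ℂ) :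
    0 ≤ (herglotzRoot A z).re := by
  rw [(herglotzRoot_re_im z).1]
  apply mul_nonneg (Real.exp_pos _).le
  obtain ⟨h1, h2⟩ := abs_le.1 (abs_re_herglotz_le hA hAsub z)
  have := Real.pi_pos
  apply Real.cos_nonneg_of_mem_Icc
  constructor <;> nlinarith

/-- In the disc the argument of `herglotzRoot` is `π/2` times a number in `[0,1]`, so the root lies
in the closed first quadrant. -/
lemma herglotzRoot_sq_im_nonneg (hA : IsCompact A) (hAsub : A ⊆ Set.Icc 0 (2 * Real.pi)) {z : ℂ}
    (hz : ‖z‖ < 1) : 0 ≤ (herglotzRoot A z ^ 2).im := by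
  obtain ⟨h1, h2⟩ := re_herglotz_mem_Icc hA hAsub hz
  have hre := herglotzRoot_re_nonneg hA hAsub z
  have him : 0 ≤ (herglotzRoot A z).im := by
    rw [(herglotzRoot_re_im z).2]
    apply mul_nonneg (Real.exp_pos _).le
    have := Real.pi_pos
    apply Real.sin_nonneg_of_nonneg_of_le_pi <;> nlinarith
  rw [sq, Complex.mul_im]
  positivity

lemma herglotzRoot_one_div_conj {z : ℂ} (hz : z ≠ 0) :
    herglotzRoot A (1 / conj z) = conj (herglotzRoot A z) := by
  unfold herglotzRoot
  rw [herglotz_one_div_conj hz, ← Complex.exp_conj]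
  simp only [map_mul, Complex.conj_ofReal, Complex.conj_I]
  ring_nf

lemma exists_herglotzRoot_eq_ofReal {z : ℂ} (hz : ‖z‖ = 1) :
    ∃ r : ℝ, 0 < r ∧ herglotzRoot A z = r := by
  have h := herglotzRoot_re_im (A := A) z
  rw [re_herglotz_eq_zero_of_norm_eq_one hz] at h
  simp only [mul_zero, Real.cos_zero, Real.sin_zero, mul_one] at h
  exact ⟨(herglotzRoot A z).re, by rw [h.1]; exact Real.exp_pos _,
    Complex.ext (by simp) (by simp [h.2])⟩

lemma differentiableAt_herglotzRoot (hA : IsCompact A) {c : ℂ} (hc : c ∉ circleSet A) :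
    DifferentiableAt ℂ (herglotzRoot A) c :=
  ((differentiableAt_herglotz hA hc).const_mul _).cexp

lemma herglotzBase_re_im : (herglotzBase A).re = Real.cos (volume.real A / 4) ∧
    (herglotzBase A).im = Real.sin (volume.real A / 4) := by
  unfold herglotzBase
  rw [Complex.exp_ofReal_mul_I_re, Complex.exp_ofReal_mul_I_im]
  exact ⟨rfl, rfl⟩

lemma norm_herglotzBase : ‖herglotzBase A‖ = 1 := Complex.norm_exp_ofReal_mul_I _

lemma herglotzBase_re_pos (hm : volume.real A < 2 * Real.pi) : 0 < (herglotzBase A).re := by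
  rw [herglotzBase_re_im.1]
  have h0 : 0 ≤ volume.real A := measureReal_nonneg
  apply Real.cos_pos_of_mem_Ioo
  constructor <;> linarith [Real.pi_pos]

lemma herglotzBase_sq_im_pos (hm0 : 0 < volume.real A) (hm : volume.real A < 2 * Real.pi) :
    0 < (herglotzBase A ^ 2).im := by
  have h1 := herglotzBase_re_pos hm
  have h2 : 0 < (herglotzBase A).im := by
    rw [herglotzBase_re_im.2]
    apply Real.sin_pos_of_pos_of_lt_pi <;> linarith [Real.pi_pos]
  rw [sq, Complex.mul_im]
  positivity

lemma herglotzRoot_add_ne_zero (hA : IsCompact A) (hAsub : A ⊆ Set.Icc 0 (2 * Real.pi))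
    {b : ℂ} (hb : 0 < b.re) (z : ℂ) : herglotzRoot A z + b ≠ 0 := by
  intro h
  have := congrArg Complex.re h
  simp at this
  linarith [herglotzRoot_re_nonneg hA hAsub z]

lemma differentiableAt_discMap (hA : IsCompact A) (hAsub : A ⊆ Set.Icc 0 (2 * Real.pi))
    (hm : volume.real A < 2 * Real.pi) {c : ℂ} (hc : c ∉ circleSet A) :
    DifferentiableAt ℂ (discMap A) c :=
  ((differentiableAt_herglotzRoot hA hc).sub_const _).div
    ((differentiableAt_herglotzRoot hA hc).add_const _)
    (herglotzRoot_add_ne_zero hA hAsub (herglotzBase_re_pos hm) c)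

lemma norm_discMap_le_one (hA : IsCompact A) (hAsub : A ⊆ Set.Icc 0 (2 * Real.pi))
    (hm : volume.real A < 2 * Real.pi) (z : ℂ) : ‖discMap A z‖ ≤ 1 := by
  unfold discMap
  rw [norm_div]
  exact div_le_one_of_le₀ (norm_sub_conj_le_norm_add (herglotzRoot_re_nonneg hA hAsub z)
    (herglotzBase_re_pos hm).le) (norm_nonneg _)

lemma discMap_zero : discMap A 0 = Complex.I * Real.sin (volume.real A / 4)
    * conj (herglotzBase A) := by
  unfold discMap
  rw [herglotzRoot_zero]
  have h1 : herglotzBase A - conj (herglotzBase A)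
      = 2 * Complex.I * Real.sin (volume.real A / 4) := by
    rw [← herglotzBase_re_im.2, Complex.sub_conj]
    push_cast
    ring
  have h0 : herglotzBase A ≠ 0 := Complex.exp_ne_zero _
  have h2 : conj (herglotzBase A) * herglotzBase A = 1 := by
    rw [mul_comm, Complex.mul_conj, Complex.normSq_eq_norm_sq, norm_herglotzBase]; simp
  rw [h1, div_eq_iff (by simpa [← two_mul] using h0)]
  linear_combination (-2 * Complex.I * Real.sin (volume.real A / 4)) * h2

lemma norm_discMap_zero (hm : volume.real A < 2 * Real.pi) :
    ‖discMap A 0‖ = Real.sin (volume.real A / 4) := by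
  rw [discMap_zero, norm_mul, norm_mul, Complex.norm_I, Complex.norm_conj, norm_herglotzBase,
    Complex.norm_real, Real.norm_eq_abs, one_mul, mul_one, abs_of_nonneg]
  have h0 : 0 ≤ volume.real A := measureReal_nonneg
  apply Real.sin_nonneg_of_nonneg_of_le_pi <;> linarith [Real.pi_pos]

/-- The quotient to which the Schwarz lemma is applied. -/
noncomputable def schwarzMap (A : Set ℝ) (z : ℂ) : ℂ :=
  (herglotzRoot A z ^ 2 - herglotzBase A ^ 2) / (herglotzRoot A z ^ 2 - conj (herglotzBase A ^ 2))

lemma sub_conj_ne_zero (hA : IsCompact A) (hAsub : A ⊆ Set.Icc 0 (2 * Real.pi))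
    (hm0 : 0 < volume.real A) (hm : volume.real A < 2 * Real.pi) {z : ℂ} (hz : ‖z‖ < 1) :
    herglotzRoot A z ^ 2 - conj (herglotzBase A ^ 2) ≠ 0 := by
  intro h
  have h1 := congrArg Complex.im h
  rw [Complex.sub_im, Complex.conj_im, Complex.zero_im] at h1
  linarith [herglotzRoot_sq_im_nonneg hA hAsub hz, herglotzBase_sq_im_pos hm0 hm]

lemma differentiableOn_schwarzMap (hA : IsCompact A) (hAsub : A ⊆ Set.Icc 0 (2 * Real.pi))
    (hm0 : 0 < volume.real A) (hm : volume.real A < 2 * Real.pi) :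
    DifferentiableOn ℂ (schwarzMap A) (Metric.ball 0 1) := by
  intro z hz
  have hz' : ‖z‖ < 1 := by simpa using hz
  have hd := (differentiableAt_herglotzRoot hA (notMem_circleSet_of_norm_ne hz'.ne)).pow 2
  exact ((hd.sub_const _).div (hd.sub_const _)
    (sub_conj_ne_zero hA hAsub hm0 hm hz')).differentiableWithinAt

lemma schwarzMap_zero : schwarzMap A 0 = 0 := by
  simp [schwarzMap, herglotzRoot_zero]

lemma mapsTo_schwarzMap (hA : IsCompact A) (hAsub : A ⊆ Set.Icc 0 (2 * Real.pi))
    (hm0 : 0 < volume.real A) (hm : volume.real A < 2 * Real.pi) :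
    Set.MapsTo (schwarzMap A) (Metric.ball 0 1) (Metric.closedBall (schwarzMap A 0) 1) := by
  intro z hz
  have hz' : ‖z‖ < 1 := by simpa using hz
  rw [schwarzMap_zero, mem_closedBall_zero_iff, schwarzMap, norm_div]
  exact div_le_one_of_le₀ (norm_sub_le_norm_sub_conj (herglotzRoot_sq_im_nonneg hA hAsub hz')
    (herglotzBase_sq_im_pos hm0 hm).le) (norm_nonneg _)

lemma norm_schwarzMap_le (hA : IsCompact A) (hAsub : A ⊆ Set.Icc 0 (2 * Real.pi))
    (hm0 : 0 < volume.real A) (hm : volume.real A < 2 * Real.pi) {z : ℂ} (hz : ‖z‖ < 1) :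
    ‖schwarzMap A z‖ ≤ ‖z‖ := by
  refine Complex.norm_le_norm_of_mapsTo_ball (differentiableOn_schwarzMap hA hAsub hm0 hm) ?_
    schwarzMap_zero hz
  have := mapsTo_schwarzMap hA hAsub hm0 hm
  rwa [schwarzMap_zero] at this

/-- With `w` the root and `b` the base, reflection conjugates `w`. So the reflected modulus is that
of `(w - b)/(w + conj b)`, and dividing by `(w - conj b)/(w + b)` leaves exactly `schwarzMap`. -/
lemma norm_discMap_one_div_conj (hA : IsCompact A) (hAsub : A ⊆ Set.Icc 0 (2 * Real.pi))
    (hm0 : 0 < volume.real A) (hm : volume.real A < 2 * Real.pi) {z : ℂ} (hz0 : z ≠ 0)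
    (hz : ‖z‖ < 1) :
    ‖discMap A (1 / conj z)‖ = ‖schwarzMap A z‖ * ‖discMap A z‖ := by
  have hre := herglotzBase_re_pos hm
  have hre' : 0 < (conj (herglotzBase A)).re := by simpa using hre
  have n1 := herglotzRoot_add_ne_zero hA hAsub hre z
  have n2 := herglotzRoot_add_ne_zero hA hAsub hre' z
  have n3 := sub_conj_ne_zero hA hAsub hm0 hm hz
  have n4 : herglotzRoot A z - conj (herglotzBase A) ≠ 0 := by
    intro h
    apply n3
    rw [map_pow]
    linear_combination (herglotzRoot A z + conj (herglotzBase A)) * h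
  have e : discMap A (1 / conj z) = conj ((herglotzRoot A z - herglotzBase A)
      / (herglotzRoot A z + conj (herglotzBase A))) := by
    unfold discMap
    rw [herglotzRoot_one_div_conj hz0]
    simp
  rw [e, Complex.norm_conj, ← norm_mul]
  congr 1
  unfold schwarzMap discMap
  rw [map_pow] at n3 ⊢
  field_simp
  ring

end

/-! ### The comparison function and its bound -/

/-- The subharmonic comparison function of the polynomial `P` of order `2 * n`. -/
noncomputable def comparison (A : Set ℝ) (P : ℂ → ℂ) (n : ℕ) (z : ℂ) : ℝ :=
  joukowskiModulus (P z) (z ^ n) * ‖discMap A z ^ (2 * n)‖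

section
variable {A : Set ℝ} {P : ℂ → ℂ} {n : ℕ}

lemma comparison_nonneg (z : ℂ) : 0 ≤ comparison A P n z :=
  mul_nonneg (joukowskiModulus_nonneg _ _) (norm_nonneg _)

lemma comparison_le (hA : IsCompact A) (hAsub : A ⊆ Set.Icc 0 (2 * Real.pi))
    (hm : volume.real A < 2 * Real.pi) (z : ℂ) :
    comparison A P n z ≤ joukowskiModulus (P z) (z ^ n) := by
  apply mul_le_of_le_one_right (joukowskiModulus_nonneg _ _)
  rw [norm_pow]
  exact pow_le_one₀ (norm_nonneg _) (norm_discMap_le_one hA hAsub hm z)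

lemma comparison_zero (hn : n ≠ 0) (hm : volume.real A < 2 * Real.pi) :
    comparison A P n 0 = 2 * ‖P 0‖ * Real.sin (volume.real A / 4) ^ (2 * n) := by
  unfold comparison
  rw [zero_pow hn, joukowskiModulus_zero_right, norm_pow, norm_discMap_zero hm]

/-- The self-reciprocity of `P` contributes `|z|^(-2n)` and the reflected `discMap` contributes
`|schwarzMap|^(2n)`. -/
lemma comparison_one_div_conj (hA : IsCompact A) (hAsub : A ⊆ Set.Icc 0 (2 * Real.pi))
    (hm0 : 0 < volume.real A) (hm : volume.real A < 2 * Real.pi)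
    (hrefl : ∀ z, z ≠ 0 → P (1 / conj z) = conj (P z) / conj z ^ (2 * n))
    {z : ℂ} (hz0 : z ≠ 0) (hz : ‖z‖ < 1) :
    comparison A P n (1 / conj z) = comparison A P n z * (‖schwarzMap A z‖ / ‖z‖) ^ (2 * n) := by
  have hc : conj z ≠ 0 := by simpa using hz0
  have hn0 : ‖z‖ ≠ 0 := norm_ne_zero_iff.2 hz0
  have e1 : conj (P z) / conj z ^ (2 * n) = (conj z ^ (2 * n))⁻¹ * conj (P z) := by ring
  have e2 : (1 / conj z) ^ n = (conj z ^ (2 * n))⁻¹ * conj (z ^ n) := by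
    rw [map_pow, div_pow, one_pow, two_mul, pow_add]
    field_simp
  unfold comparison
  rw [hrefl z hz0, e1, e2, joukowskiModulus_mul, joukowskiModulus_conj, norm_pow,
    norm_discMap_one_div_conj hA hAsub hm0 hm hz0 hz, norm_inv, norm_pow, Complex.norm_conj,
    norm_pow, div_pow, mul_pow]
  field_simp

lemma comparison_one_div_conj_le (hA : IsCompact A) (hAsub : A ⊆ Set.Icc 0 (2 * Real.pi))
    (hm0 : 0 < volume.real A) (hm : volume.real A < 2 * Real.pi)
    (hrefl : ∀ z, z ≠ 0 → P (1 / conj z) = conj (P z) / conj z ^ (2 * n))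
    {z : ℂ} (hz0 : z ≠ 0) (hz : ‖z‖ < 1) :
    comparison A P n (1 / conj z) ≤ comparison A P n z := by
  rw [comparison_one_div_conj hA hAsub hm0 hm hrefl hz0 hz]
  apply mul_le_of_le_one_right (comparison_nonneg z)
  apply pow_le_one₀ (by positivity)
  exact div_le_one_of_le₀ (norm_schwarzMap_le hA hAsub hm0 hm hz) (norm_nonneg _)

lemma continuousAt_comparison (hA : IsCompact A) (hAsub : A ⊆ Set.Icc 0 (2 * Real.pi))
    (hm : volume.real A < 2 * Real.pi) (hP : Continuous P) {c : ℂ} (hc : c ∉ circleSet A) :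
    ContinuousAt (comparison A P n) c := by
  unfold comparison
  refine ContinuousAt.mul ?_ ?_
  · exact (continuous_joukowskiModulus.comp (hP.prodMk (continuous_pow n))).continuousAt
  · exact (((differentiableAt_discMap hA hAsub hm hc).continuousAt).pow _).norm

lemma comparison_eventually_eq (hA : IsCompact A) (hAsub : A ⊆ Set.Icc 0 (2 * Real.pi))
    (hm : volume.real A < 2 * Real.pi) (hP : Differentiable ℂ P) {c : ℂ} (hc : c ∉ circleSet A)
    (hmax : IsLocalMax (comparison A P n) c) :
    ∀ᶠ z in 𝓝 c, comparison A P n z = comparison A P n c := by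
  refine eventually_eq_of_isLocalMax_joukowskiModulus hP (by fun_prop) ?_ hmax
  filter_upwards [(isCompact_circleSet hA).isClosed.isOpen_compl.mem_nhds hc] with z hz
  exact (differentiableAt_discMap hA hAsub hm hz).pow _

/-- A global maximum over the closed disc off `circleSet A` is a local maximum in the plane. -/
lemma isLocalMax_comparison (hA : IsCompact A) (hAsub : A ⊆ Set.Icc 0 (2 * Real.pi))
    (hm0 : 0 < volume.real A) (hm : volume.real A < 2 * Real.pi)
    (hrefl : ∀ z, z ≠ 0 → P (1 / conj z) = conj (P z) / conj z ^ (2 * n))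
    {c : ℂ} (hc : c ∉ circleSet A)
    (hmax : ∀ z, ‖z‖ ≤ 1 → z ∉ circleSet A → comparison A P n z ≤ comparison A P n c) :
    IsLocalMax (comparison A P n) c := by
  filter_upwards [(isCompact_circleSet hA).isClosed.isOpen_compl.mem_nhds hc] with z hz
  rcases le_or_gt ‖z‖ 1 with h | h
  · exact hmax z h hz
  · have h0 : z ≠ 0 := by rintro rfl; simp at h; linarith
    have hlt : ‖1 / conj z‖ < 1 := by
      rw [norm_div, norm_one, Complex.norm_conj, div_lt_one (by positivity)]
      exact h
    have hne : 1 / conj z ≠ 0 := by simpa using h0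
    have e : 1 / conj (1 / conj z) = z := by simp
    have := comparison_one_div_conj_le hA hAsub hm0 hm hrefl hne hlt
    rw [e] at this
    exact this.trans (hmax _ hlt.le (notMem_circleSet_of_norm_ne hlt.ne))

/-- If the maximum is attained at a point of the closed disc, then `comparison` is constant
on the open disc. -/
lemma comparison_eq_on_ball (hA : IsCompact A) (hAsub : A ⊆ Set.Icc 0 (2 * Real.pi))
    (hm0 : 0 < volume.real A) (hm : volume.real A < 2 * Real.pi) (hP : Differentiable ℂ P)
    (hrefl : ∀ z, z ≠ 0 → P (1 / conj z) = conj (P z) / conj z ^ (2 * n))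
    {c : ℂ} (hcn : ‖c‖ ≤ 1) (hc : c ∉ circleSet A)
    (hmax : ∀ z, ‖z‖ ≤ 1 → z ∉ circleSet A → comparison A P n z ≤ comparison A P n c) :
    ∀ z, ‖z‖ < 1 → comparison A P n z = comparison A P n c := by
  have hloc := comparison_eventually_eq hA hAsub hm hP hc
    (isLocalMax_comparison hA hAsub hm0 hm hrefl hc hmax)
  -- A maximum on the circle spreads to a neighbourhood, hence to a point of the open disc;
  -- connectedness of the disc does the rest.
  obtain ⟨d, hd, hdc⟩ : ∃ d, ‖d‖ < 1 ∧ comparison A P n d = comparison A P n c := by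
    have hcl : c ∈ closure (Metric.ball (0 : ℂ) 1) := by
      rw [closure_ball _ one_ne_zero]; simpa using hcn
    obtain ⟨d, hd1, hd2⟩ := mem_closure_iff_nhds.1 hcl _ hloc
    exact ⟨d, by simpa using hd2, hd1⟩
  have hopen : IsOpen {z | ‖z‖ < 1 ∧ comparison A P n z = comparison A P n c} := by
    rw [isOpen_iff_mem_nhds]
    rintro z ⟨hz1, hz2⟩
    have hzE : z ∉ circleSet A := notMem_circleSet_of_norm_ne hz1.ne
    have hlz := comparison_eventually_eq hA hAsub hm hP hzE
      (isLocalMax_comparison hA hAsub hm0 hm hrefl hzE (by rw [hz2]; exact hmax))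
    filter_upwards [hlz, continuous_norm.continuousAt.eventually_lt continuousAt_const hz1]
      with u h1 h2
    exact ⟨h2, h1.trans hz2⟩
  have hopen2 : IsOpen {z | ‖z‖ < 1 ∧ comparison A P n z ≠ comparison A P n c} := by
    rw [isOpen_iff_mem_nhds]
    rintro z ⟨hz1, hz2⟩
    have hzE : z ∉ circleSet A := notMem_circleSet_of_norm_ne hz1.ne
    filter_upwards [(continuousAt_comparison hA hAsub hm hP.continuous hzE).eventually_ne hz2,
      continuous_norm.continuousAt.eventually_lt continuousAt_const hz1] with u h1 h2
    exact ⟨h2, h1⟩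
  intro z hz
  by_contra hne
  obtain ⟨x, -, h1, h2⟩ := (convex_ball (0 : ℂ) 1).isPreconnected _ _ hopen hopen2
    (fun x hx => by
      have hx' : ‖x‖ < 1 := by simpa using hx
      by_cases h : comparison A P n x = comparison A P n c
      · exact Or.inl ⟨hx', h⟩
      · exact Or.inr ⟨hx', h⟩)
    ⟨d, by simpa using hd, hd, hdc⟩ ⟨z, by simpa using hz, hz, hne⟩
  exact h2.2 h1.2

/-- No boundary values of `comparison` on `circleSet A` are needed, since it is dominated by the
continuous `joukowskiModulus`. If it exceeded 1 at `z₀`, the points where that majorant reaches this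
value would form a compact set avoiding `circleSet A`, so a global maximum would be attained. Then
`comparison` is constant on the disc, and the majorant stays above 1 up to `circleSet A`, which
contradicts `hPE`. -/
theorem comparison_le_one (hA : IsCompact A) (hAsub : A ⊆ Set.Icc 0 (2 * Real.pi))
    (hm0 : 0 < volume.real A) (hm : volume.real A < 2 * Real.pi) (hP : Differentiable ℂ P)
    (hrefl : ∀ z, z ≠ 0 → P (1 / conj z) = conj (P z) / conj z ^ (2 * n))
    (hPE : ∀ z ∈ circleSet A, joukowskiModulus (P z) (z ^ n) ≤ 1) :
    ∀ z, ‖z‖ ≤ 1 → z ∉ circleSet A → comparison A P n z ≤ 1 := by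
  intro z₀ hz₀ hz₀E
  by_contra hgt
  push Not at hgt
  have hKc : Continuous fun z => joukowskiModulus (P z) (z ^ n) :=
    continuous_joukowskiModulus.comp (hP.continuous.prodMk (continuous_pow n))
  have hC : IsCompact (Metric.closedBall (0 : ℂ) 1 ∩
      {z | comparison A P n z₀ ≤ joukowskiModulus (P z) (z ^ n)}) :=
    (isCompact_closedBall _ _).inter_right (isClosed_le continuous_const hKc)
  have hCE : ∀ z ∈ Metric.closedBall (0 : ℂ) 1 ∩
      {z | comparison A P n z₀ ≤ joukowskiModulus (P z) (z ^ n)}, z ∉ circleSet A := by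
    rintro z ⟨-, hz⟩ hzE
    have h1 := hPE z hzE
    have h2 : comparison A P n z₀ ≤ joukowskiModulus (P z) (z ^ n) := hz
    linarith
  have hz₀C : z₀ ∈ Metric.closedBall (0 : ℂ) 1 ∩
      {z | comparison A P n z₀ ≤ joukowskiModulus (P z) (z ^ n)} :=
    ⟨by simpa using hz₀, comparison_le hA hAsub hm z₀⟩
  obtain ⟨c, hcC, hcmax⟩ := hC.exists_isMaxOn ⟨z₀, hz₀C⟩
    (f := comparison A P n) (fun z hz => (continuousAt_comparison hA hAsub hm hP.continuous
      (hCE z hz)).continuousWithinAt)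
  have hz₀c : comparison A P n z₀ ≤ comparison A P n c := hcmax hz₀C
  have hmax : ∀ z, ‖z‖ ≤ 1 → z ∉ circleSet A → comparison A P n z ≤ comparison A P n c := by
    intro z hz hzE
    by_cases hzC : comparison A P n z₀ ≤ joukowskiModulus (P z) (z ^ n)
    · exact hcmax ⟨by simpa using hz, hzC⟩
    · exact (comparison_le hA hAsub hm z).trans ((not_le.1 hzC).le.trans hz₀c)
  have hconst := comparison_eq_on_ball hA hAsub hm0 hm hP hrefl (by simpa using hcC.1)
    (hCE c hcC) hmax
  obtain ⟨t, ht⟩ : A.Nonempty := by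
    rw [Set.nonempty_iff_ne_empty]
    rintro rfl
    simp at hm0
  have hcl : Complex.exp (t * Complex.I) ∈ closure (Metric.ball (0 : ℂ) 1) := by
    rw [closure_ball _ one_ne_zero]
    simp [Complex.norm_exp_ofReal_mul_I]
  have hge : comparison A P n c ≤ joukowskiModulus (P (Complex.exp (t * Complex.I)))
      (Complex.exp (t * Complex.I) ^ n) := by
    refine closure_minimal ?_ (isClosed_le continuous_const hKc) hcl
    intro z hz
    have hz' : ‖z‖ < 1 := by simpa using hz
    have := comparison_le (P := P) (n := n) hA hAsub hm z
    rw [hconst z hz'] at this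
    exact this
  linarith [hPE _ (exp_mem_circleSet ht)]

end

/-! ### The equality case -/

lemma eval_chebyshev_half_add_inv {x : ℂ} (hx : x ≠ 0) (n : ℕ) :
    (Polynomial.Chebyshev.T ℂ (n : ℤ)).eval ((x + x⁻¹) / 2) = (x ^ n + (x ^ n)⁻¹) / 2 := by
  have h := Polynomial.Chebyshev.T_complex_cosh (Complex.log x) n
  have e1 : Complex.cosh (Complex.log x) = (x + x⁻¹) / 2 := by
    rw [Complex.cosh, Complex.exp_neg, Complex.exp_log hx]
  have e2 : Complex.cosh ((n : ℤ) * Complex.log x) = (x ^ n + (x ^ n)⁻¹) / 2 := by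
    rw [Complex.cosh, Complex.exp_neg, Int.cast_natCast, Complex.exp_nat_mul, Complex.exp_log hx]
  rw [← e1, h, e2]

lemma conj_eq_self_of_mul_add_conj_mul {c : ℂ} {x a : ℝ} (hx1 : x < 1)
    (h : (a : ℂ) = c + conj c * x) : conj c = c := by
  have him := congrArg Complex.im h
  simp at him
  have : c.im = 0 := by
    have : c.im * (1 - x) = 0 := by linarith
    exact (mul_eq_zero.1 this).resolve_right (by linarith)
  exact Complex.conj_eq_iff_im.2 this

section
variable {A : Set ℝ} {P : ℂ → ℂ} {n : ℕ}

lemma herglotzBase_mul_conj : herglotzBase A * conj (herglotzBase A) = 1 := by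
  rw [Complex.mul_conj, Complex.normSq_eq_norm_sq, norm_herglotzBase]; simp

lemma herglotzBase_add_conj :
    herglotzBase A + conj (herglotzBase A) = 2 * Real.cos (volume.real A / 4) := by
  rw [Complex.add_conj, herglotzBase_re_im.1]
  push_cast
  ring

/-- The product of `discMap` with its reflection. -/
noncomputable def symmDiscMap (A : Set ℝ) (z : ℂ) : ℂ :=
  ((herglotzRoot A z - conj (herglotzBase A)) * (herglotzRoot A z - herglotzBase A)) /
    ((herglotzRoot A z + conj (herglotzBase A)) * (herglotzRoot A z + herglotzBase A))

lemma symmDiscMap_eq (hA : IsCompact A) (hAsub : A ⊆ Set.Icc 0 (2 * Real.pi))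
    (hm0 : 0 < volume.real A) (hm : volume.real A < 2 * Real.pi) {z : ℂ} (hz : ‖z‖ < 1) :
    symmDiscMap A z = schwarzMap A z * discMap A z ^ 2 := by
  have hre := herglotzBase_re_pos hm
  have hre' : 0 < (conj (herglotzBase A)).re := by simpa using hre
  have n1 := herglotzRoot_add_ne_zero hA hAsub hre z
  have n2 := herglotzRoot_add_ne_zero hA hAsub hre' z
  have n3 := sub_conj_ne_zero hA hAsub hm0 hm hz
  rw [map_pow] at n3
  unfold symmDiscMap schwarzMap discMap
  rw [map_pow]
  field_simp
  ring

lemma continuousAt_symmDiscMap (hA : IsCompact A) (hAsub : A ⊆ Set.Icc 0 (2 * Real.pi))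
    (hm : volume.real A < 2 * Real.pi) {c : ℂ} (hc : c ∉ circleSet A) :
    ContinuousAt (symmDiscMap A) c := by
  have hre := herglotzBase_re_pos hm
  have hre' : 0 < (conj (herglotzBase A)).re := by simpa using hre
  have hw := (differentiableAt_herglotzRoot hA hc).continuousAt
  unfold symmDiscMap
  exact ((hw.sub continuousAt_const).mul (hw.sub continuousAt_const)).div
    ((hw.add continuousAt_const).mul (hw.add continuousAt_const))
    (mul_ne_zero (herglotzRoot_add_ne_zero hA hAsub hre' c)
      (herglotzRoot_add_ne_zero hA hAsub hre c))

/-- On the circle `herglotzRoot` is a positive real `w`, so the conjugate factors multiply to `w² ∓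
2w cos(m/4) + 1`, with `m` the measure of `A`. -/
lemma exists_symmDiscMap_eq_ofReal (hm0 : 0 < volume.real A) (hm : volume.real A < 2 * Real.pi)
    {z : ℂ} (hz : ‖z‖ = 1) : ∃ r : ℝ, 0 < r ∧ r < 1 ∧ symmDiscMap A z = r := by
  obtain ⟨w, hw0, hw⟩ := exists_herglotzRoot_eq_ofReal (A := A) hz
  set c := Real.cos (volume.real A / 4) with hc
  have hc0 : 0 < c := by
    rw [hc, ← herglotzBase_re_im.1]; exact herglotzBase_re_pos hm
  have hc1 : c < 1 := by
    rw [hc, ← Real.cos_zero]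
    apply Real.cos_lt_cos_of_nonneg_of_le_pi <;> linarith [Real.pi_pos]
  have hnum : 0 < w ^ 2 - 2 * c * w + 1 := by nlinarith [sq_nonneg (w - 1)]
  have hden : 0 < w ^ 2 + 2 * c * w + 1 := by positivity
  refine ⟨(w ^ 2 - 2 * c * w + 1) / (w ^ 2 + 2 * c * w + 1), by positivity, ?_, ?_⟩
  · rw [div_lt_one hden]
    nlinarith
  · have h1 := herglotzBase_mul_conj (A := A)
    have h2 := herglotzBase_add_conj (A := A)
    rw [← hc] at h2
    unfold symmDiscMap
    rw [hw]
    push_cast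
    congr 1
    · linear_combination h1 - w * h2
    · linear_combination h1 + w * h2

/-- When `schwarzMap` is a rotation, `symmDiscMap` is an explicit algebraic function. -/
lemma symmDiscMap_add_inv (hA : IsCompact A) (hAsub : A ⊆ Set.Icc 0 (2 * Real.pi))
    (hm0 : 0 < volume.real A) (hm : volume.real A < 2 * Real.pi) {z κ : ℂ} (hz : ‖z‖ < 1)
    (hz0 : z ≠ 0) (hκ : ‖κ‖ = 1) (hs : schwarzMap A z = κ * z) :
    symmDiscMap A z ≠ 0 ∧ (symmDiscMap A z + (symmDiscMap A z)⁻¹) / 2 =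
      ((1 / Real.sin (volume.real A / 4) ^ 2 - 1 : ℝ) : ℂ)
        - ((1 / Real.sin (volume.real A / 4) ^ 2 : ℝ) : ℂ) *
          ((κ * conj (herglotzBase A) ^ 2 * z + (κ * conj (herglotzBase A) ^ 2 * z)⁻¹) / 2) := by
  have hre := herglotzBase_re_pos hm
  have hre' : 0 < (conj (herglotzBase A)).re := by simpa using hre
  have n1 := herglotzRoot_add_ne_zero hA hAsub hre z
  have n2 := herglotzRoot_add_ne_zero hA hAsub hre' z
  have n3 := sub_conj_ne_zero hA hAsub hm0 hm hz
  have hb := herglotzBase_mul_conj (A := A)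
  have h2 := herglotzBase_add_conj (A := A)
  have hs0 : Real.sin (volume.real A / 4) ≠ 0 := by
    apply ne_of_gt
    apply Real.sin_pos_of_pos_of_lt_pi <;> linarith [Real.pi_pos]
  have hκ0 : κ ≠ 0 := by rintro rfl; simp at hκ
  rw [map_pow] at n3
  unfold schwarzMap at hs
  rw [map_pow, div_eq_iff n3] at hs
  have n5 : (herglotzRoot A z - conj (herglotzBase A)) * (herglotzRoot A z - herglotzBase A)
      ≠ 0 := by
    intro h
    have h5 : (herglotzRoot A z ^ 2 - herglotzBase A ^ 2) *
        (herglotzRoot A z ^ 2 - conj (herglotzBase A) ^ 2) = 0 := by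
      linear_combination (herglotzRoot A z + conj (herglotzBase A)) *
        (herglotzRoot A z + herglotzBase A) * h
    rw [hs, mul_assoc, mul_eq_zero] at h5
    rcases h5 with h5 | h5
    · exact mul_ne_zero hκ0 hz0 h5
    · exact mul_ne_zero n3 n3 h5
  have hSC : (Real.sin (volume.real A / 4) : ℂ) ^ 2 + (Real.cos (volume.real A / 4) : ℂ) ^ 2
      = 1 := by
    have := Real.sin_sq_add_cos_sq (volume.real A / 4)
    exact_mod_cast this
  have hs0' : (Real.sin (volume.real A / 4) : ℂ) ≠ 0 := by exact_mod_cast hs0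
  have hb0 : herglotzBase A ≠ 0 := Complex.exp_ne_zero _
  have hcb0 : conj (herglotzBase A) ≠ 0 := by simpa using hb0
  refine ⟨div_ne_zero n5 (mul_ne_zero n2 n1), ?_⟩
  unfold symmDiscMap
  simp only [Complex.ofReal_sub, Complex.ofReal_div, Complex.ofReal_one, Complex.ofReal_pow]
  generalize (Real.sin (volume.real A / 4) : ℂ) = s at *
  generalize (Real.cos (volume.real A / 4) : ℂ) = c at *
  generalize herglotzRoot A z = w at *
  generalize conj (herglotzBase A) = b' at *
  generalize herglotzBase A = b at *
  have hl0 : κ * z ≠ 0 := mul_ne_zero hκ0 hz0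
  have einv : (κ * b' ^ 2 * z)⁻¹ = b ^ 2 / (κ * z) := by
    rw [inv_eq_iff_eq_inv, inv_div, eq_div_iff (pow_ne_zero 2 hb0)]
    linear_combination κ * z * (b * b' + 1) * hb
  have emul : κ * b' ^ 2 * z = κ * z * b' ^ 2 := by ring
  rw [einv, emul]
  generalize κ * z = l at *
  obtain ⟨V, hV⟩ : ∃ V, V = w ^ 2 - b' ^ 2 := ⟨_, rfl⟩
  rw [← hV] at hs n3
  -- The product of numerator and denominator of `symmDiscMap` is `(w² - b²)(w² - b'²)`; the
  -- rotation hypothesis makes it `l V²`.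
  have hND : ((w - b') * (w - b)) * ((w + b') * (w + b)) = l * V ^ 2 := by
    linear_combination (w ^ 2 - b' ^ 2) * hs - l * V * hV
  have e1 : b ^ 2 + b' ^ 2 = 2 - 4 * s ^ 2 := by
    linear_combination (b + b' + 2 * c) * h2 - 2 * hb + 4 * hSC
  have e2 : (b ^ 2 - b' ^ 2) ^ 2 = -16 * s ^ 2 * c ^ 2 := by
    have e3 : (b + b') ^ 2 = 4 * c ^ 2 := by rw [h2]; ring
    have e4 : (b - b') ^ 2 = -4 * s ^ 2 := by linear_combination e1 - 2 * hb
    linear_combination (b - b') ^ 2 * e3 + 4 * c ^ 2 * e4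
  have e5 : V * (1 - l) = b ^ 2 - b' ^ 2 := by linear_combination hV + hs
  have e6 : V * (b ^ 2 - l * b' ^ 2) = w ^ 2 * (b ^ 2 - b' ^ 2) := by
    linear_combination b' ^ 2 * hs + b ^ 2 * hV
  have key : 16 * s ^ 2 * c ^ 2 * w ^ 2
      = V ^ 2 * (2 * l - l ^ 2 * b' ^ 2 - b ^ 2 - 4 * s ^ 2 * l) := by
    have e7 : V ^ 2 * (2 * l - l ^ 2 * b' ^ 2 - b ^ 2 - 4 * s ^ 2 * l)
        = -(V * (1 - l)) * (V * (b ^ 2 - l * b' ^ 2)) := by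
      linear_combination -V ^ 2 * l * e1
    rw [e7, e5, e6]
    linear_combination w ^ 2 * e2
  have hD : (w + b') * (w + b) ≠ 0 := mul_ne_zero n2 n1
  -- For a quotient `N/D`, `(N/D + D/N)/2 = 1 + (N - D)²/(2ND)`, and here `N - D = -4cw`.
  have elhs : (((w - b') * (w - b)) / ((w + b') * (w + b))
      + (((w - b') * (w - b)) / ((w + b') * (w + b)))⁻¹) / 2
      = 1 + 8 * c ^ 2 * w ^ 2 / (l * V ^ 2) := by
    have hdiff : (w - b') * (w - b) = (w + b') * (w + b) - 4 * c * w := by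
      linear_combination -2 * w * h2
    rw [← hND]
    rw [hdiff] at n5 ⊢
    generalize (w + b') * (w + b) = D at *
    field_simp
    ring
  rw [elhs]
  field_simp
  linear_combination key

end

/-- A function that is constant on the open disc has that value at every continuity point
of the closed disc. -/
lemma eq_of_forall_norm_lt_one {β : Type*} [TopologicalSpace β] [T2Space β] {F G : ℂ → β} {z : ℂ}
    (hz : ‖z‖ = 1) (hF : ContinuousAt F z) (hG : ContinuousAt G z)
    (h : ∀ u, ‖u‖ < 1 → u ≠ 0 → F u = G u) : F z = G z := by
  have hcl : z ∈ closure (Metric.ball (0 : ℂ) 1) := by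
    rw [closure_ball _ one_ne_zero]; simp [hz]
  have := mem_closure_iff_nhdsWithin_neBot.1 hcl
  have hz0 : z ≠ 0 := by rintro rfl; simp at hz
  refine tendsto_nhds_unique (l := 𝓝[Metric.ball (0 : ℂ) 1] z)
    (hF.mono_left nhdsWithin_le_nhds) ((hG.mono_left nhdsWithin_le_nhds).congr' ?_)
  filter_upwards [self_mem_nhdsWithin, nhdsWithin_le_nhds (isOpen_ne.mem_nhds hz0)] with u hu hu0
  exact (h u (by simpa using hu) hu0).symm

section
variable {A : Set ℝ} {P : ℂ → ℂ} {n : ℕ}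

/-- In the extremal situation `schwarzMap` is a rotation. -/
lemma exists_schwarzMap_eq_mul (hA : IsCompact A) (hAsub : A ⊆ Set.Icc 0 (2 * Real.pi))
    (hm0 : 0 < volume.real A) (hm : volume.real A < 2 * Real.pi) (hP : Differentiable ℂ P)
    (hn : n ≠ 0)
    (hrefl : ∀ z, z ≠ 0 → P (1 / conj z) = conj (P z) / conj z ^ (2 * n))
    (hle : ∀ z, ‖z‖ ≤ 1 → z ∉ circleSet A → comparison A P n z ≤ 1)
    (hconst : ∀ z, ‖z‖ < 1 → comparison A P n z = 1)
    {z₁ : ℂ} (hz₁ : ‖z₁‖ = 1) (hz₁A : z₁ ∉ circleSet A) :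
    ∃ κ : ℂ, ‖κ‖ = 1 ∧ ∀ z, ‖z‖ < 1 → schwarzMap A z = κ * z := by
  have hz₁0 : z₁ ≠ 0 := by rintro rfl; simp at hz₁
  have h1 : comparison A P n z₁ = 1 :=
    eq_of_forall_norm_lt_one hz₁ (continuousAt_comparison hA hAsub hm hP.continuous hz₁A)
      continuousAt_const (fun u hu _ => hconst u hu)
  have hloc := comparison_eventually_eq hA hAsub hm hP hz₁A
    (isLocalMax_comparison hA hAsub hm0 hm hrefl hz₁A (by rw [h1]; exact hle))
  rw [h1] at hloc
  have hcι : ContinuousAt (fun z : ℂ => 1 / conj z) z₁ :=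
    continuousAt_const.div Complex.continuous_conj.continuousAt (by simpa using hz₁0)
  have hι : 1 / conj z₁ = z₁ := by
    rw [div_eq_iff (by simpa using hz₁0), Complex.mul_conj, Complex.normSq_eq_norm_sq, hz₁]
    simp
  have hloc2 : ∀ᶠ z in 𝓝 z₁, comparison A P n (1 / conj z) = 1 := by
    have hι' : Tendsto (fun z : ℂ => 1 / conj z) (𝓝 z₁) (𝓝 z₁) := by
      have := hcι.tendsto
      rwa [hι] at this
    exact hι'.eventually hloc
  have hcl : z₁ ∈ closure (Metric.ball (0 : ℂ) 1) := by
    rw [closure_ball _ one_ne_zero]; simp [hz₁]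
  -- At a nonzero `d` in the disc close to `z₁` the function is 1 at `d` and at its reflection, so
  -- the reflection factor is 1: equality in the Schwarz lemma.
  obtain ⟨d, ⟨hd1, hd0⟩, hdb⟩ := mem_closure_iff_nhds.1 hcl _
    (hloc2.and (isOpen_ne.mem_nhds hz₁0))
  have hd : ‖d‖ < 1 := by simpa using hdb
  have hd0' : d ≠ 0 := hd0
  have hdn : ‖d‖ ≠ 0 := norm_ne_zero_iff.2 hd0'
  rw [comparison_one_div_conj hA hAsub hm0 hm hrefl hd0' hd, hconst d hd, one_mul,
    pow_eq_one_iff_of_nonneg (by positivity) (by omega), div_eq_one_iff_eq hdn] at hd1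
  have hslope : ‖dslope (schwarzMap A) 0 d‖ = 1 / 1 := by
    rw [dslope_of_ne _ hd0', slope_def_field, schwarzMap_zero, sub_zero, sub_zero, norm_div, hd1]
    simp [hdn]
  have haff := Complex.affine_of_mapsTo_ball_of_norm_dslope_eq_div
    (differentiableOn_schwarzMap hA hAsub hm0 hm) (mapsTo_schwarzMap hA hAsub hm0 hm)
    (by simpa using hd) hslope
  refine ⟨dslope (schwarzMap A) 0 d, by rw [hslope]; simp, fun z hz => ?_⟩
  rw [haff (by simpa using hz), schwarzMap_zero]
  simp [mul_comm]

/-- In the extremal situation the larger root times the power of `discMap` is constant. -/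
lemma joukowskiRoot_mul_discMap (hA : IsCompact A) (hAsub : A ⊆ Set.Icc 0 (2 * Real.pi))
    (hm : volume.real A < 2 * Real.pi) (hP : Differentiable ℂ P) (hn : n ≠ 0)
    (hconst : ∀ z, ‖z‖ < 1 → comparison A P n z = 1) :
    ∀ z, ‖z‖ < 1 → P z ≠ 0 ∧
      joukowskiRoot (P z) (z ^ n) * discMap A z ^ (2 * n) = 2 * P 0 * discMap A 0 ^ (2 * n) := by
  -- Since `comparison` is 1 on the disc, the modulus of the root is at least `1 > |z|^n`: the
  -- analytic branch is available on the whole disc.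
  have hlt : ∀ z, ‖z‖ < 1 → ‖z ^ n‖ < joukowskiModulus (P z) (z ^ n) := by
    intro z hz
    have h1 := comparison_le (P := P) (n := n) hA hAsub hm z
    rw [hconst z hz] at h1
    rw [norm_pow]
    exact (pow_lt_one₀ (norm_nonneg _) hz hn).trans_le h1
  have hne : ∀ z, ‖z‖ < 1 → P z ≠ 0 := fun z hz => (ne_zero_and_mem_slitPlane_of_lt (hlt z hz)).1
  intro z hz
  refine ⟨hne z hz, ?_⟩
  have hnorm : ∀ u, ‖u‖ < 1 →
      ‖joukowskiRoot (P u) (u ^ n) * discMap A u ^ (2 * n)‖ = 1 := by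
    intro u hu
    rw [norm_mul, (norm_joukowskiRoot (hne u hu)).2]
    exact hconst u hu
  have hd : DifferentiableOn ℂ (fun u => joukowskiRoot (P u) (u ^ n) * discMap A u ^ (2 * n))
      (Metric.ball 0 1) := by
    intro u hu
    have hu' : ‖u‖ < 1 := by simpa using hu
    exact (((hP u).joukowskiRoot (differentiableAt_id.pow n) (hlt u hu')).mul
      ((differentiableAt_discMap hA hAsub hm
        (notMem_circleSet_of_norm_ne hu'.ne)).pow _)).differentiableWithinAt
  have key := Complex.eqOn_of_isPreconnected_of_isMaxOn_norm
    (convex_ball (0 : ℂ) 1).isPreconnected Metric.isOpen_ball hd (c := 0) (by simp)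
    (fun u hu => by
      have h1 := hnorm u (by simpa using hu)
      have h0 := hnorm 0 (by simp)
      simp only [Function.comp, Set.mem_ofPred_eq]
      rw [h1, h0])
  have := key (show z ∈ Metric.ball 0 1 by simpa using hz)
  simp only [Function.const] at this
  rw [this]
  have h0 : joukowskiRoot (P 0) (0 ^ n) = 2 * P 0 := by
    unfold joukowskiRoot
    rw [zero_pow hn]
    simp
    ring
  rw [h0]

/-- The equality case of the comparison. -/
theorem exists_eq_chebyshev_of_comparison_eq_one (hA : IsCompact A)
    (hAsub : A ⊆ Set.Icc 0 (2 * Real.pi))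
    (hm0 : 0 < volume.real A) (hm : volume.real A < 2 * Real.pi) (hP : Differentiable ℂ P)
    (hn : n ≠ 0)
    (hrefl : ∀ z, z ≠ 0 → P (1 / conj z) = conj (P z) / conj z ^ (2 * n))
    (hreal : ∀ z, ‖z‖ = 1 → ∃ r : ℝ, P z = r * z ^ n)
    (hPE : ∀ z ∈ circleSet A, joukowskiModulus (P z) (z ^ n) ≤ 1)
    {y : ℝ} (hy : P 0 = (y / 2 : ℝ)) (heq : y * Real.sin (volume.real A / 4) ^ (2 * n) = 1)
    {z₁ : ℂ} (hz₁ : ‖z₁‖ = 1) (hz₁A : z₁ ∉ circleSet A) :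
    ∃ ω : ℂ, ω ^ (2 * n) = 1 ∧ ∀ z, ‖z‖ = 1 → P z = z ^ n * ((-1) ^ n * ω ^ n *
      (Polynomial.Chebyshev.T ℂ (n : ℤ)).eval
        (((1 / Real.sin (volume.real A / 4) ^ 2 - 1 : ℝ) : ℂ)
          - ((1 / Real.sin (volume.real A / 4) ^ 2 : ℝ) : ℂ) * ((ω * z + (ω * z)⁻¹) / 2))) := by
  have hsin : 0 < Real.sin (volume.real A / 4) := by
    apply Real.sin_pos_of_pos_of_lt_pi <;> linarith [Real.pi_pos]
  have hypos : 0 < y := by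
    by_contra h
    have := mul_nonpos_of_nonpos_of_nonneg (not_lt.1 h)
      (pow_nonneg hsin.le (2 * n))
    linarith
  have h0 : comparison A P n 0 = 1 := by
    rw [comparison_zero hn hm, hy, Complex.norm_real, Real.norm_eq_abs,
      abs_of_pos (by positivity), ← heq]
    ring
  have hle := comparison_le_one hA hAsub hm0 hm hP hrefl hPE
  have h0A : (0 : ℂ) ∉ circleSet A := notMem_circleSet_of_norm_ne (by simp)
  have hconst : ∀ z, ‖z‖ < 1 → comparison A P n z = 1 := by
    intro z hz
    rw [← h0]
    exact comparison_eq_on_ball hA hAsub hm0 hm hP hrefl (by simp) h0A (by rw [h0]; exact hle) z hz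
  obtain ⟨κ, hκ, hs⟩ := exists_schwarzMap_eq_mul hA hAsub hm0 hm hP hn hrefl hle hconst hz₁ hz₁A
  have hroot := joukowskiRoot_mul_discMap hA hAsub hm hP hn hconst
  -- The base contributes the remaining rotation: `ω z` is the variable in `symmDiscMap_add_inv`,
  -- and `c` is the constant in `X ψ^n = c z^n`.
  set ω := κ * conj (herglotzBase A) ^ 2 with hω
  set c := (-1) ^ n * ω ^ n with hc
  have hωn : ‖ω‖ = 1 := by
    rw [hω, norm_mul, norm_pow, Complex.norm_conj, norm_herglotzBase, hκ]; simp
  have hcn : ‖c‖ = 1 := by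
    rw [hc, norm_mul, norm_pow, norm_pow, hωn]; simp
  have hc0 : c ≠ 0 := norm_ne_zero_iff.1 (by rw [hcn]; exact one_ne_zero)
  have hcval : 2 * P 0 * discMap A 0 ^ (2 * n) * κ ^ n = c := by
    have e : (y : ℂ) * (Real.sin (volume.real A / 4) : ℂ) ^ (2 * n) = 1 := by exact_mod_cast heq
    rw [hy, discMap_zero, hc, hω, mul_pow, mul_pow, mul_pow, pow_mul Complex.I, Complex.I_sq,
      ← pow_mul]
    push_cast at e ⊢
    linear_combination ((-1) ^ n * conj (herglotzBase A) ^ (2 * n) * κ ^ n) * e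
  have hcconj : c * conj c = 1 := by
    rw [Complex.mul_conj, Complex.normSq_eq_norm_sq, hcn]; simp
  -- The roots multiply to `z^(2n)`, so `2P = X + z^(2n)/X`; substitute `X = c z^n / ψ^n`, with `ψ =
  -- κ z B²`.
  have hsymm : ∀ z, ‖z‖ < 1 → z ≠ 0 → symmDiscMap A z ≠ 0 ∧
      2 * P z = z ^ n * (c * (symmDiscMap A z ^ n)⁻¹ + conj c * symmDiscMap A z ^ n) := by
    intro z hz hz0
    obtain ⟨hψ0, -⟩ := symmDiscMap_add_inv hA hAsub hm0 hm hz hz0 hκ (hs z hz)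
    refine ⟨hψ0, ?_⟩
    obtain ⟨hPz, hX⟩ := hroot z hz
    have hXeq := joukowskiRoot_eqn (q := z ^ n) hPz
    have hX0 := (norm_joukowskiRoot (q := z ^ n) hPz).1
    have hψ : symmDiscMap A z ^ n = κ ^ n * z ^ n * discMap A z ^ (2 * n) := by
      rw [symmDiscMap_eq hA hAsub hm0 hm hz, hs z hz, mul_pow, mul_pow, ← pow_mul]
    have hXψ : joukowskiRoot (P z) (z ^ n) * symmDiscMap A z ^ n = c * z ^ n := by
      rw [hψ, ← hcval]
      linear_combination (κ ^ n * z ^ n) * hX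
    have hψn0 : symmDiscMap A z ^ n ≠ 0 := pow_ne_zero _ hψ0
    generalize joukowskiRoot (P z) (z ^ n) = X at *
    generalize symmDiscMap A z ^ n = ψ at *
    have hXv : X = c * z ^ n / ψ := by rw [eq_div_iff hψn0, hXψ]
    have h2P : 2 * P z = X + (z ^ n) ^ 2 / X := by
      field_simp
      linear_combination -hXeq
    have hccinv : conj c = c⁻¹ := eq_inv_of_mul_eq_one_right hcconj
    have hzn : z ^ n ≠ 0 := pow_ne_zero _ hz0
    rw [h2P, hXv, hccinv]
    field_simp
  -- At `z₁` both `P/z^n` and `ψ ∈ (0,1)` are real, which leaves no room for an imaginary part of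
  -- `c`. The identity is cleared of `ψ⁻¹` before passing to the boundary.
  have hcreal : conj c = c := by
    obtain ⟨r, hr⟩ := hreal z₁ hz₁
    obtain ⟨ψ, hψ0, hψ1, hψ⟩ := exists_symmDiscMap_eq_ofReal hm0 hm hz₁
    have hz₁0 : z₁ ≠ 0 := by rintro rfl; simp at hz₁
    have hψc := continuousAt_symmDiscMap hA hAsub hm hz₁A
    have := eq_of_forall_norm_lt_one hz₁
      (F := fun z => 2 * P z * symmDiscMap A z ^ n)
      (G := fun z => z ^ n * (c + conj c * (symmDiscMap A z ^ n) ^ 2))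
      ((continuousAt_const.mul hP.continuous.continuousAt).mul (hψc.pow n))
      ((continuousAt_id.pow n).mul
        (continuousAt_const.add (continuousAt_const.mul ((hψc.pow n).pow 2))))
      (fun u hu hu0 => by
        obtain ⟨h1, h2⟩ := hsymm u hu hu0
        have := pow_ne_zero n h1
        rw [h2]
        field_simp)
    rw [hr, hψ] at this
    have hzn : z₁ ^ n ≠ 0 := pow_ne_zero _ hz₁0
    refine conj_eq_self_of_mul_add_conj_mul (x := (ψ ^ n) ^ 2) (a := 2 * r * ψ ^ n) ?_ ?_
    · rw [← pow_mul]
      exact pow_lt_one₀ hψ0.le hψ1 (by omega)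
    · apply mul_left_cancel₀ hzn
      push_cast
      linear_combination this
  have hc2 : c ^ 2 = 1 := by
    rw [hcreal] at hcconj
    rw [sq, hcconj]
  have hω0 : ω ≠ 0 := norm_ne_zero_iff.1 (by rw [hωn]; exact one_ne_zero)
  refine ⟨ω, ?_, fun z hz => ?_⟩
  · have : c ^ 2 = ω ^ (2 * n) := by
      rw [hc, mul_pow, ← pow_mul, ← pow_mul, mul_comm n 2, pow_mul (-1 : ℂ)]
      simp
    rw [← this, hc2]
  · have hz0 : z ≠ 0 := by rintro rfl; simp at hz
    refine eq_of_forall_norm_lt_one hz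
      (F := P) (G := fun z => z ^ n * (c * (Polynomial.Chebyshev.T ℂ (n : ℤ)).eval
        (((1 / Real.sin (volume.real A / 4) ^ 2 - 1 : ℝ) : ℂ)
          - ((1 / Real.sin (volume.real A / 4) ^ 2 : ℝ) : ℂ) * ((ω * z + (ω * z)⁻¹) / 2))))
      hP.continuous.continuousAt ?_ ?_
    · refine (continuousAt_id.pow n).mul (continuousAt_const.mul
        ((Polynomial.continuous _).continuousAt.comp ?_))
      refine continuousAt_const.sub (continuousAt_const.mul (ContinuousAt.div_const ?_ 2))
      have hlin : ContinuousAt (fun z : ℂ => ω * z) z := by fun_prop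
      exact hlin.add (hlin.inv₀ (mul_ne_zero hω0 hz0))
    · intro u hu hu0
      obtain ⟨h1, h2⟩ := symmDiscMap_add_inv hA hAsub hm0 hm hu hu0 hκ (hs u hu)
      rw [← hω] at h2
      rw [← h2, eval_chebyshev_half_add_inv h1]
      have h3 := (hsymm u hu hu0).2
      rw [hcreal] at h3
      linear_combination h3 / 2

end

/-! ### Trigonometric polynomials as self-reciprocal algebraic polynomials -/

lemma exists_exp_eq_of_norm_eq_one {z : ℂ} (hz : ‖z‖ = 1) :
    ∃ t : ℝ, z = Complex.exp (t * Complex.I) := by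
  refine ⟨z.arg, ?_⟩
  have := Complex.norm_mul_exp_arg_mul_I z
  rw [hz] at this
  simpa using this.symm

/-- The monomial pair representing `a cos kt + b sin kt` times `e ^ (i n t)`. -/
lemma harmonic_mul_exp (a b t : ℝ) {k n : ℕ} (hk : k ≤ n) :
    ((a - b * Complex.I) / 2) * Complex.exp (t * Complex.I) ^ (n + k)
      + ((a + b * Complex.I) / 2) * Complex.exp (t * Complex.I) ^ (n - k)
      = Complex.exp (t * Complex.I) ^ n * ((a * Real.cos (k * t) + b * Real.sin (k * t) : ℝ) : ℂ)
      := by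
  obtain ⟨j, rfl⟩ := Nat.exists_eq_add_of_le hk
  have hc : (Real.cos (k * t) : ℂ) = (Complex.exp (t * Complex.I) ^ k
      + (Complex.exp (t * Complex.I) ^ k)⁻¹) / 2 := by
    rw [Complex.ofReal_cos, Complex.cos, ← Complex.exp_nat_mul, ← Complex.exp_neg]
    push_cast
    ring_nf
  have hs : (Real.sin (k * t) : ℂ) = ((Complex.exp (t * Complex.I) ^ k)⁻¹
      - Complex.exp (t * Complex.I) ^ k) * Complex.I / 2 := by
    rw [Complex.ofReal_sin, Complex.sin, ← Complex.exp_nat_mul, ← Complex.exp_neg]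
    push_cast
    ring_nf
  rw [Complex.ofReal_add, Complex.ofReal_mul, Complex.ofReal_mul, hc, hs,
    Nat.add_sub_cancel_left]
  have h0 : Complex.exp (t * Complex.I) ≠ 0 := Complex.exp_ne_zero _
  generalize Complex.exp (t * Complex.I) = u at *
  rw [pow_add, pow_add]
  field_simp
  ring_nf

lemma harmonic_one_div_conj (a b : ℝ) {k n : ℕ} (hk : k ≤ n) {z : ℂ} (hz : z ≠ 0) :
    ((a - b * Complex.I) / 2) * (1 / conj z) ^ (n + k)
      + ((a + b * Complex.I) / 2) * (1 / conj z) ^ (n - k)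
      = conj (((a - b * Complex.I) / 2) * z ^ (n + k) + ((a + b * Complex.I) / 2) * z ^ (n - k))
        / conj z ^ (2 * n) := by
  obtain ⟨j, rfl⟩ := Nat.exists_eq_add_of_le hk
  have hc : conj z ≠ 0 := by simpa using hz
  rw [Nat.add_sub_cancel_left]
  simp only [map_add, map_mul, map_div₀, map_sub, map_pow, Complex.conj_ofReal, Complex.conj_I,
    map_ofNat]
  generalize conj z = u at *
  rw [show k + j + k = j + (2 * k) by ring, show 2 * (k + j) = 2 * j + 2 * k by ring]
  simp only [div_pow, one_pow, pow_add, two_mul j]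
  field_simp
  ring

/-- The algebraic polynomial `z ^ n * f` attached to a trigonometric polynomial. -/
theorem exists_algebraic_of_mem_trigPolyLeading {n : ℕ} (hn : 1 ≤ n) {y : ℝ} {f : ℝ → ℝ}
    (hf : f ∈ trigPolyLeading n y) :
    ∃ P : ℂ → ℂ, Differentiable ℂ P ∧ P 0 = (y / 2 : ℝ) ∧
      (∀ z, z ≠ 0 → P (1 / conj z) = conj (P z) / conj z ^ (2 * n)) ∧
      ∀ t : ℝ, P (Complex.exp (t * Complex.I)) = f t * Complex.exp (t * Complex.I) ^ n := by
  obtain ⟨g, ⟨a, b, hg⟩, hf⟩ := hf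
  let h : ℝ → ℝ → ℕ → ℂ → ℂ := fun a b k z =>
    ((a - b * Complex.I) / 2) * z ^ (n + k) + ((a + b * Complex.I) / 2) * z ^ (n - k)
  have hzero : ∀ a b : ℝ, ∀ k, k < n → h a b k 0 = 0 := by
    intro a b k hk
    simp only [h]
    rw [zero_pow (by omega), zero_pow (by omega)]
    simp
  -- Only the harmonic `k = n` has a constant term, `y/2`. The constant `a₀/2` is entered as the
  -- harmonic `k = 0`, whose two monomials coincide.
  refine ⟨fun z => h y 0 n z + h (a 0 / 2) 0 0 z + ∑ k ∈ Finset.Icc 1 (n - 1), h (a k) (b k) k z,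
    ?_, ?_, ?_, ?_⟩
  · simp only [h]
    fun_prop
  · have hsum : ∑ k ∈ Finset.Icc 1 (n - 1), h (a k) (b k) k 0 = 0 :=
      Finset.sum_eq_zero fun k hk => hzero _ _ k (by rw [Finset.mem_Icc] at hk; omega)
    beta_reduce
    rw [hsum, hzero _ _ 0 (by omega)]
    simp only [h]
    rw [zero_pow (by omega), Nat.sub_self]
    simp
  · intro z hz
    simp only [map_add, map_sum, add_div, Finset.sum_div]
    have key : ∀ a b : ℝ, ∀ k, k ≤ n → h a b k (1 / conj z) = conj (h a b k z) / conj z ^ (2 * n) :=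
      fun a b k hk => harmonic_one_div_conj a b hk hz
    rw [key _ _ n le_rfl, key _ _ 0 (by omega)]
    congr 1
    exact Finset.sum_congr rfl fun k hk => key _ _ k (by rw [Finset.mem_Icc] at hk; omega)
  · intro t
    have key : ∀ a b : ℝ, ∀ k, k ≤ n → h a b k (Complex.exp (t * Complex.I))
        = Complex.exp (t * Complex.I) ^ n
          * ((a * Real.cos (k * t) + b * Real.sin (k * t) : ℝ) : ℂ) :=
      fun a b k hk => harmonic_mul_exp a b t hk
    simp only
    rw [key _ _ n le_rfl, key _ _ 0 (by omega), Finset.sum_congr rfl fun k hk =>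
      key _ _ k (by rw [Finset.mem_Icc] at hk; omega), ← Finset.mul_sum, ← mul_add, ← mul_add,
      mul_comm, hf, hg]
    congr 1
    push_cast
    simp
    ring

lemma continuous_of_mem_trigPolyLeading {n : ℕ} {y : ℝ} {f : ℝ → ℝ}
    (hf : f ∈ trigPolyLeading n y) : Continuous f := by
  obtain ⟨g, ⟨a, b, hg⟩, hf⟩ := hf
  have : f = fun t => y * Real.cos (n * t) + (a 0 / 2 + ∑ k ∈ Finset.Icc 1 (n - 1),
      (a k * Real.cos (k * t) + b k * Real.sin (k * t))) := by
    ext t; rw [hf, hg]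
  rw [this]
  fun_prop

lemma joukowskiModulus_le_one_of_abs_le {x : ℝ} {q : ℂ} (hx : |x| ≤ 1) (hq : ‖q‖ = 1) :
    joukowskiModulus (x * q) q ≤ 1 := by
  rw [joukowskiModulus_real_mul hx, hq]

/-! ### The lower bound for the deviation and uniqueness -/

/-- This is `comparison ≤ 1` read at the origin, where `P` is `y/2` and `|discMap|` is the sine. A
general compact `A` is allowed, so that a sublevel set of full measure can be truncated. -/
theorem mul_sin_pow_le_one {n : ℕ} (hn : 1 ≤ n) {y : ℝ} (hy : 0 < y) {f : ℝ → ℝ}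
    (hf : f ∈ trigPolyLeading n y) {A : Set ℝ} (hA : IsCompact A)
    (hAsub : A ⊆ Set.Icc 0 (2 * Real.pi)) (hm : volume.real A < 2 * Real.pi)
    (hfA : ∀ t ∈ A, |f t| ≤ 1) : y * Real.sin (volume.real A / 4) ^ (2 * n) ≤ 1 := by
  rcases eq_or_lt_of_le (measureReal_nonneg (μ := volume) (s := A)) with h0 | hm0
  · rw [← h0, zero_div, Real.sin_zero, zero_pow (by omega), mul_zero]
    exact zero_le_one
  obtain ⟨P, hP, hP0, hrefl, hPf⟩ := exists_algebraic_of_mem_trigPolyLeading hn hf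
  have hPE : ∀ z ∈ circleSet A, joukowskiModulus (P z) (z ^ n) ≤ 1 := by
    rintro z ⟨t, ht, rfl⟩
    simp only
    rw [hPf]
    exact joukowskiModulus_le_one_of_abs_le (hfA t ht)
      (by rw [norm_pow, Complex.norm_exp_ofReal_mul_I, one_pow])
  have := comparison_le_one hA hAsub hm0 hm hP hrefl hPE 0 (by simp)
    (notMem_circleSet_of_norm_ne (by simp))
  rw [comparison_zero (by omega) hm, hP0, Complex.norm_real, Real.norm_eq_abs,
    abs_of_pos (by positivity)] at this
  linarith

lemma exp_neg_pow_facts {n k : ℕ} (hn : 1 ≤ n) {ω : ℂ}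
    (hω : Complex.exp (2 * Real.pi * Complex.I * (k / (2 * n : ℕ))) = ω⁻¹) (t : ℝ) :
    ω ^ n = (-1) ^ k ∧
      ω * Complex.exp (t * Complex.I)
        = Complex.exp (((t - Real.pi * k / n : ℝ) : ℂ) * Complex.I) := by
  have hn0 : (n : ℂ) ≠ 0 := by exact_mod_cast (by omega : n ≠ 0)
  have hω' : ω = Complex.exp (-(Real.pi * k / n * Complex.I)) := by
    rw [Complex.exp_neg, ← inv_inv ω, ← hω]
    congr 2
    push_cast
    field_simp
  constructor
  · rw [hω', ← Complex.exp_nat_mul]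
    have : (n : ℂ) * -(Real.pi * k / n * Complex.I) = (k : ℂ) * (-(Real.pi * Complex.I)) := by
      field_simp
    rw [this, Complex.exp_nat_mul, Complex.exp_neg, Complex.exp_pi_mul_I]
    norm_num
  · rw [hω', ← Complex.exp_add]
    congr 1
    push_cast
    ring

lemma one_div_sq_rpow {n : ℕ} (hn : 1 ≤ n) {y : ℝ} (hy : 0 < y) :
    1 / (1 / y ^ (1 / (2 * (n : ℝ)))) ^ 2 = y ^ (1 / (n : ℝ)) ∧
      y * (1 / y ^ (1 / (2 * (n : ℝ)))) ^ (2 * n) = 1 := by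
  have hn0 : (n : ℝ) ≠ 0 := by exact_mod_cast (by omega : n ≠ 0)
  have hp : 0 < y ^ (1 / (2 * (n : ℝ))) := Real.rpow_pos_of_pos hy _
  have e1 : (y ^ (1 / (2 * (n : ℝ)))) ^ 2 = y ^ (1 / (n : ℝ)) := by
    rw [← Real.rpow_natCast, ← Real.rpow_mul hy.le]
    congr 1
    push_cast
    field_simp
  have e2 : (y ^ (1 / (2 * (n : ℝ)))) ^ (2 * n) = y := by
    rw [← Real.rpow_natCast, ← Real.rpow_mul hy.le]
    push_cast
    rw [one_div_mul_cancel (by positivity), Real.rpow_one]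
  constructor
  · rw [div_pow, one_pow, one_div_one_div, e1]
  · rw [div_pow, one_pow, e2]
    field_simp

/-- The set where a polynomial is at most one in modulus. -/
def sublevel (f : ℝ → ℝ) : Set ℝ := {t | t ∈ Set.Icc 0 (2 * Real.pi) ∧ |f t| ≤ 1}

lemma isCompact_sublevel {f : ℝ → ℝ} (hf : Continuous f) : IsCompact (sublevel f) :=
  isCompact_Icc.inter_right (isClosed_le hf.abs continuous_const)

lemma sublevel_subset (f : ℝ → ℝ) : sublevel f ⊆ Set.Icc 0 (2 * Real.pi) := fun _ h => h.1

lemma volume_real_Icc_two_pi : volume.real (Set.Icc 0 (2 * Real.pi)) = 2 * Real.pi := by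
  rw [measureReal_def, Real.volume_Icc, sub_zero, ENNReal.toReal_ofReal (by positivity)]

lemma two_pi_le_deviationMeasure_add (f : ℝ → ℝ) :
    2 * Real.pi ≤ deviationMeasure f + volume.real (sublevel f) := by
  unfold deviationMeasure
  have hsub : ∀ s : Set ℝ, s ⊆ Set.Icc 0 (2 * Real.pi) → volume s ≠ ⊤ := fun s hs =>
    ((measure_mono hs).trans_lt measure_Icc_lt_top).ne
  refine volume_real_Icc_two_pi.symm.le.trans
    (le_trans (measureReal_mono ?_ ?_) (measureReal_union_le _ _))
  · intro t ht
    rcases le_total 1 |f t| with h | h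
    · exact Or.inl ⟨ht, h⟩
    · exact Or.inr ⟨ht, h⟩
  · apply hsub
    rintro t (h | h)
    · exact h.1
    · exact h.1

theorem volume_sublevel_le {n : ℕ} (hn : 1 ≤ n) {y : ℝ} (hy : 1 < y) {f : ℝ → ℝ}
    (hf : f ∈ trigPolyLeading n y) :
    volume.real (sublevel f) ≤ 4 * Real.arcsin (1 / y ^ (1 / (2 * (n : ℝ)))) := by
  have hy0 : 0 < y := by linarith
  obtain ⟨-, hr⟩ := one_div_sq_rpow hn hy0
  set r := 1 / y ^ (1 / (2 * (n : ℝ))) with hrdef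
  have hr0 : 0 < r := by rw [hrdef]; positivity
  have hr1 : r < 1 := by
    rw [hrdef, div_lt_one (by positivity)]
    exact Real.one_lt_rpow hy (by positivity)
  have hβ : Real.arcsin r < Real.pi / 2 := by
    rw [← not_le, Real.pi_div_two_le_arcsin]
    linarith
  have key : ∀ B ⊆ sublevel f, IsCompact B → volume.real B < 2 * Real.pi →
      volume.real B ≤ 4 * Real.arcsin r := by
    intro B hB hBc hBm
    have h1 := mul_sin_pow_le_one hn hy0 hf hBc (hB.trans (sublevel_subset f)) hBm
      (fun t ht => (hB ht).2)
    have hB0 : 0 ≤ volume.real B := measureReal_nonneg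
    have h2 : Real.sin (volume.real B / 4) ≤ r := by
      refine le_of_pow_le_pow_left₀ (n := 2 * n) (by omega) hr0.le ?_
      rw [← hr] at h1
      exact le_of_mul_le_mul_left h1 hy0
    have h3 : volume.real B / 4 ≤ Real.arcsin r := by
      rw [Real.le_arcsin_iff_sin_le' ⟨by linarith [Real.pi_pos], by linarith⟩]
      exact h2
    linarith
  have hc := isCompact_sublevel (continuous_of_mem_trigPolyLeading hf)
  by_contra hlt
  push Not at hlt
  rcases lt_or_ge (volume.real (sublevel f)) (2 * Real.pi) with h | h
  · linarith [key _ subset_rfl hc h]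
  -- A sublevel set of full measure is outside the scope of the comparison, so it is cut to `[0, x]`
  -- with `x` midway between `4 arcsin r` and `2π`; the cut set has measure `x`, too large for
  -- `key`.
  · set x := 2 * Real.arcsin r + Real.pi with hx
    have hx1 : 4 * Real.arcsin r < x := by linarith
    have hx2 : x < 2 * Real.pi := by linarith
    have hx0 : 0 ≤ x := by linarith [Real.arcsin_nonneg.2 hr0.le, Real.pi_pos]
    have hB1 : volume.real (sublevel f ∩ Set.Icc 0 x) ≤ x := by
      refine (measureReal_mono Set.inter_subset_right (by simp)).trans ?_
      rw [measureReal_def, Real.volume_Icc, sub_zero, ENNReal.toReal_ofReal hx0]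
    have hB2 : x ≤ volume.real (sublevel f ∩ Set.Icc 0 x) := by
      have : volume.real (sublevel f) ≤ volume.real (sublevel f ∩ Set.Icc 0 x)
          + volume.real (Set.Icc x (2 * Real.pi)) := by
        refine le_trans (measureReal_mono ?_ ?_) (measureReal_union_le _ _)
        · intro t ht
          rcases le_total t x with h | h
          · exact Or.inl ⟨ht, ht.1.1, h⟩
          · exact Or.inr ⟨h, ht.1.2⟩
        · exact ((hc.inter_right isClosed_Icc).union isCompact_Icc).measure_lt_top.ne
      rw [measureReal_def (s := Set.Icc x _), Real.volume_Icc, ENNReal.toReal_ofReal (by linarith)]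
        at this
      linarith
    have := key _ Set.inter_subset_left (hc.inter_right isClosed_Icc) (by linarith)
    linarith

theorem arccos_le_deviationMeasure {n : ℕ} (hn : 1 ≤ n) {y : ℝ} (hy : 1 < y) {f : ℝ → ℝ}
    (hf : f ∈ trigPolyLeading n y) :
    4 * Real.arccos (1 / y ^ (1 / (2 * (n : ℝ)))) ≤ deviationMeasure f := by
  rw [Real.arccos]
  linarith [volume_sublevel_le hn hy hf, two_pi_le_deviationMeasure_add f]

theorem eq_extremalPoly_of_deviationMeasure {n : ℕ} (hn : 1 ≤ n) {y : ℝ} (hy : 1 < y) {f : ℝ → ℝ}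
    (hf : f ∈ trigPolyLeading n y)
    (hdev : deviationMeasure f = 4 * Real.arccos (1 / y ^ (1 / (2 * (n : ℝ))))) :
    ∃ k : ℕ, k < 2 * n ∧ f = extremalPoly n y k := by
  have hy0 : 0 < y := by linarith
  obtain ⟨hr2, hr⟩ := one_div_sq_rpow hn hy0
  have hle := volume_sublevel_le hn hy hf
  have hge := two_pi_le_deviationMeasure_add f
  rw [hdev, Real.arccos] at hge
  set r := 1 / y ^ (1 / (2 * (n : ℝ))) with hrdef
  have hr0 : 0 < r := by rw [hrdef]; positivity
  have hr1 : r < 1 := by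
    rw [hrdef, div_lt_one (by positivity)]
    exact Real.one_lt_rpow hy (by positivity)
  have hβ : Real.arcsin r < Real.pi / 2 := by
    rw [← not_le, Real.pi_div_two_le_arcsin]
    linarith
  have hβ0 : 0 < Real.arcsin r := Real.arcsin_pos.2 hr0
  have hmeq : volume.real (sublevel f) = 4 * Real.arcsin r := by linarith
  have hsin : Real.sin (volume.real (sublevel f) / 4) = r := by
    rw [hmeq, mul_div_cancel_left₀ _ (by norm_num : (4 : ℝ) ≠ 0),
      Real.sin_arcsin (by linarith) hr1.le]
  have hm0 : 0 < volume.real (sublevel f) := by linarith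
  have hm : volume.real (sublevel f) < 2 * Real.pi := by linarith
  have hA := isCompact_sublevel (continuous_of_mem_trigPolyLeading hf)
  obtain ⟨P, hP, hP0, hrefl, hPf⟩ := exists_algebraic_of_mem_trigPolyLeading hn hf
  have hPE : ∀ z ∈ circleSet (sublevel f), joukowskiModulus (P z) (z ^ n) ≤ 1 := by
    rintro z ⟨t, ht, rfl⟩
    simp only
    rw [hPf]
    exact joukowskiModulus_le_one_of_abs_le ht.2
      (by rw [norm_pow, Complex.norm_exp_ofReal_mul_I, one_pow])
  have hreal : ∀ z : ℂ, ‖z‖ = 1 → ∃ x : ℝ, P z = x * z ^ n := by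
    intro z hz
    obtain ⟨t, rfl⟩ := exists_exp_eq_of_norm_eq_one hz
    exact ⟨f t, hPf t⟩
  obtain ⟨s, hs, hsA⟩ : ∃ s ∈ Set.Icc 0 (2 * Real.pi), s ∉ sublevel f := by
    by_contra hall
    push Not at hall
    have : sublevel f = Set.Icc 0 (2 * Real.pi) := (sublevel_subset f).antisymm hall
    rw [this, volume_real_Icc_two_pi] at hm
    exact lt_irrefl _ hm
  -- The exponential identifies `0` and `2π`, so `s ∉ sublevel f` alone is not enough; but `f`
  -- depends only on the point of the circle.
  have hs1 : Complex.exp (s * Complex.I) ∉ circleSet (sublevel f) := by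
    rintro ⟨t, ht, hts⟩
    simp only at hts
    apply hsA
    refine ⟨hs, ?_⟩
    have h1 := hPf s
    rw [← hts, hPf t] at h1
    have h2 : f t = f s := by
      have := mul_right_cancel₀ (pow_ne_zero n (Complex.exp_ne_zero _)) h1
      exact_mod_cast this
    rw [← h2]
    exact ht.2
  obtain ⟨ω, hω, hPω⟩ := exists_eq_chebyshev_of_comparison_eq_one hA (sublevel_subset f) hm0 hm hP
    (by omega) hrefl hreal hPE hP0 (by rw [hsin, hr]) (Complex.norm_exp_ofReal_mul_I s) hs1
  have hω0 : ω ≠ 0 := by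
    rintro rfl
    rw [zero_pow (by omega)] at hω
    exact zero_ne_one hω
  have : NeZero (2 * n) := ⟨by omega⟩
  -- The index is taken from `ω⁻¹`, because `ω e^(it)` must be `e^(i(t - πk/n))`.
  obtain ⟨k, hk, hkω⟩ := (Complex.mem_rootsOfUnity (2 * n) (Units.mk0 ω hω0)⁻¹).1
    (by rw [mem_rootsOfUnity, Units.ext_iff]; simp [hω])
  rw [Units.val_inv_eq_inv_val, Units.val_mk0] at hkω
  refine ⟨k, hk, funext fun t => ?_⟩
  have h1 := hPω _ (Complex.norm_exp_ofReal_mul_I t)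
  obtain ⟨e1, e2⟩ := exp_neg_pow_facts hn hkω t
  have e3 : ∀ x : ℝ, (Complex.exp (x * Complex.I) + (Complex.exp (x * Complex.I))⁻¹) / 2
      = (Real.cos x : ℂ) := by
    intro x
    rw [Complex.ofReal_cos, Complex.cos, ← Complex.exp_neg, neg_mul]
  rw [hPf, mul_comm, e2, e3, e1, hsin, hr2] at h1
  have h2 := mul_left_cancel₀ (pow_ne_zero n (Complex.exp_ne_zero _)) h1
  rw [← Complex.ofReal_mul, ← Complex.ofReal_sub, ← Polynomial.Chebyshev.complex_ofReal_eval_T]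
    at h2
  have h3 : f t = (-1) ^ n * (-1) ^ k * (Polynomial.Chebyshev.T ℝ (n : ℤ)).eval
      (y ^ (1 / (n : ℝ)) - 1 - y ^ (1 / (n : ℝ)) * Real.cos (t - Real.pi * k / n)) := by
    exact_mod_cast h2
  have h4 : y ^ (1 / (n : ℝ)) - 1 - y ^ (1 / (n : ℝ)) * Real.cos (t - Real.pi * k / n)
      = -(y ^ (1 / (n : ℝ)) * Real.cos (t - Real.pi * k / n) - y ^ (1 / (n : ℝ)) + 1) := by ring
  have h5 : ((Int.negOnePow (n : ℤ) : ℤˣ) : ℝ) = (-1) ^ n := by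
    rw [Int.negOnePow_def]
    simp
  have h6 : ((-1 : ℝ) ^ n) * (-1) ^ n = 1 := by
    rw [← mul_pow]; simp
  -- The parity of the Chebyshev polynomial absorbs the sign `(-1)^n`.
  rw [h3, h4, Polynomial.Chebyshev.T_eval_neg, extremalPoly, h5]
  linear_combination ((-1) ^ k * (Polynomial.Chebyshev.T ℝ (n : ℤ)).eval
    (y ^ (1 / (n : ℝ)) * Real.cos (t - Real.pi * k / n) - y ^ (1 / (n : ℝ)) + 1)) * h6

/-! ### Membership of the extremal polynomials -/

lemma trigPoly_succ {d : ℕ} {g : ℝ → ℝ} (hg : g ∈ trigPoly d) (u v : ℝ) :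
    (fun t => u * Real.cos ((d + 1 : ℕ) * t) + v * Real.sin ((d + 1 : ℕ) * t) + g t)
      ∈ trigPoly (d + 1) := by
  obtain ⟨a, b, hg⟩ := hg
  refine ⟨fun k => if k = d + 1 then u else a k, fun k => if k = d + 1 then v else b k,
    fun t => ?_⟩
  rw [Finset.sum_Icc_succ_top (by omega)]
  have : ∑ k ∈ Finset.Icc 1 d, ((if k = d + 1 then u else a k) * Real.cos (k * t)
      + (if k = d + 1 then v else b k) * Real.sin (k * t))
      = ∑ k ∈ Finset.Icc 1 d, (a k * Real.cos (k * t) + b k * Real.sin (k * t)) := by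
    refine Finset.sum_congr rfl fun k hk => ?_
    rw [Finset.mem_Icc] at hk
    rw [if_neg (by omega), if_neg (by omega)]
  beta_reduce
  rw [this, hg, if_neg (by omega), if_pos rfl, if_pos rfl]
  ring

lemma trigPoly_const_mul {d : ℕ} {g : ℝ → ℝ} (hg : g ∈ trigPoly d) (c : ℝ) :
    (fun t => c * g t) ∈ trigPoly d := by
  obtain ⟨a, b, hg⟩ := hg
  refine ⟨fun k => c * a k, fun k => c * b k, fun t => ?_⟩
  beta_reduce
  rw [hg, mul_add, Finset.mul_sum]
  congr 1
  · ring
  · exact Finset.sum_congr rfl fun k _ => by ring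

/-- The Chebyshev polynomial of degree `d + 1` has leading coefficient `2^d`, so the top terms
cancel. This is the induction step for expanding a polynomial in a cosine. -/
lemma natDegree_sub_chebyshev_le {d : ℕ} {p : Polynomial ℝ} (hp : p.natDegree ≤ d + 1) :
    (p - Polynomial.C (p.coeff (d + 1) / 2 ^ d)
      * Polynomial.Chebyshev.T ℝ ((d + 1 : ℕ) : ℤ)).natDegree ≤ d := by
  have hT : (Polynomial.Chebyshev.T ℝ ((d + 1 : ℕ) : ℤ)).natDegree = d + 1 := by
    rw [Polynomial.Chebyshev.natDegree_T, Int.natAbs_natCast]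
  have hlc : (Polynomial.Chebyshev.T ℝ ((d + 1 : ℕ) : ℤ)).coeff (d + 1) = 2 ^ d := by
    have := Polynomial.Chebyshev.leadingCoeff_T ℝ ((d + 1 : ℕ) : ℤ)
    rw [Polynomial.leadingCoeff, hT, Int.natAbs_natCast] at this
    simpa using this
  refine Polynomial.natDegree_le_pred (n := d + 1) ?_ ?_
  · refine (Polynomial.natDegree_sub_le _ _).trans (max_le hp ?_)
    exact (Polynomial.natDegree_C_mul_le _ _).trans hT.le
  · rw [Polynomial.coeff_sub, Polynomial.coeff_C_mul, hlc, div_mul_cancel₀ _ (by positivity),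
      sub_self]

lemma eval_cos_eq {d : ℕ} (p : Polynomial ℝ) (x : ℝ) :
    p.eval (Real.cos x) = p.coeff (d + 1) / 2 ^ d * Real.cos ((d + 1 : ℕ) * x)
      + (p - Polynomial.C (p.coeff (d + 1) / 2 ^ d)
        * Polynomial.Chebyshev.T ℝ ((d + 1 : ℕ) : ℤ)).eval (Real.cos x) := by
  have := Polynomial.Chebyshev.T_real_cos x ((d + 1 : ℕ) : ℤ)
  rw [Int.cast_natCast] at this
  rw [Polynomial.eval_sub, Polynomial.eval_mul, Polynomial.eval_C, this]
  ring

/-- An algebraic polynomial in `cos (t - τ)` is a trigonometric polynomial of the same degree. -/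
lemma eval_cos_sub_mem_trigPoly (τ : ℝ) : ∀ (d : ℕ) (p : Polynomial ℝ), p.natDegree ≤ d →
    (fun t => p.eval (Real.cos (t - τ))) ∈ trigPoly d
  | 0, p, hp => by
    refine ⟨fun _ => 2 * p.coeff 0, 0, fun t => ?_⟩
    rw [Polynomial.eq_C_of_natDegree_le_zero hp]
    simp
  | d + 1, p, hp => by
    have h := trigPoly_succ (eval_cos_sub_mem_trigPoly τ d _ (natDegree_sub_chebyshev_le hp))
      (p.coeff (d + 1) / 2 ^ d * Real.cos ((d + 1 : ℕ) * τ))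
      (p.coeff (d + 1) / 2 ^ d * Real.sin ((d + 1 : ℕ) * τ))
    convert h using 2 with t
    rw [eval_cos_eq (d := d) p, mul_sub, Real.cos_sub]
    ring

/-- Composition with a linear map of slope `y^(1/n)` multiplies the leading Chebyshev coefficient by
`y`, so the top harmonic is `y cos n(t - πk/n) = (-1)^k y cos nt`; the outer sign removes `(-1)^k`.
-/
lemma extremalPoly_mem {n : ℕ} (hn : 1 ≤ n) {y : ℝ} (hy : 1 < y) (k : ℕ) :
    extremalPoly n y k ∈ trigPolyLeading n y := by
  obtain ⟨d, rfl⟩ := Nat.exists_eq_add_of_le' hn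
  have hn0 : ((d + 1 : ℕ) : ℝ) ≠ 0 := by exact_mod_cast d.succ_ne_zero
  set Y := y ^ (1 / ((d + 1 : ℕ) : ℝ)) with hY
  have hYpos : 0 < Y := Real.rpow_pos_of_pos (by linarith) _
  have hYn : Y ^ (d + 1) = y := by
    rw [hY, ← Real.rpow_natCast, ← Real.rpow_mul (by linarith), one_div_mul_cancel hn0,
      Real.rpow_one]
  set q : Polynomial ℝ := Polynomial.C Y * Polynomial.X + Polynomial.C (1 - Y) with hq
  set p := (Polynomial.Chebyshev.T ℝ ((d + 1 : ℕ) : ℤ)).comp q with hp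
  have hqd : q.natDegree = 1 := Polynomial.natDegree_linear hYpos.ne'
  have hTd : (Polynomial.Chebyshev.T ℝ ((d + 1 : ℕ) : ℤ)).natDegree = d + 1 := by
    rw [Polynomial.Chebyshev.natDegree_T, Int.natAbs_natCast]
  have hpd : p.natDegree = d + 1 := by
    rw [hp, Polynomial.natDegree_comp, hqd, hTd, mul_one]
  have hpc : p.coeff (d + 1) = 2 ^ d * y := by
    have h1 : p.leadingCoeff = p.coeff (d + 1) := by rw [Polynomial.leadingCoeff, hpd]
    have h2 : q.leadingCoeff = Y := Polynomial.leadingCoeff_linear hYpos.ne'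
    rw [← h1, hp, Polynomial.leadingCoeff_comp (by rw [hqd]; exact one_ne_zero),
      Polynomial.Chebyshev.leadingCoeff_T, h2, hTd, hYn, Int.natAbs_natCast, Nat.add_sub_cancel]
  have hpe : ∀ x, p.eval x = (Polynomial.Chebyshev.T ℝ ((d + 1 : ℕ) : ℤ)).eval (Y * x - Y + 1) := by
    intro x
    rw [hp, Polynomial.eval_comp, hq]
    congr 1
    simp
    ring
  refine ⟨_, trigPoly_const_mul (eval_cos_sub_mem_trigPoly (Real.pi * k / (d + 1 : ℕ)) d _
    (natDegree_sub_chebyshev_le hpd.le)) ((-1) ^ k), fun t => ?_⟩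
  have hcos : Real.cos ((d + 1 : ℕ) * (t - Real.pi * k / (d + 1 : ℕ)))
      = (-1) ^ k * Real.cos ((d + 1 : ℕ) * t) := by
    rw [← Real.cos_sub_nat_mul_pi]
    congr 1
    field_simp
  have hsq : ((-1 : ℝ) ^ k) * (-1) ^ k = 1 := by
    rw [← mul_pow]; simp
  unfold extremalPoly
  rw [← hY, ← hpe, eval_cos_eq (d := d) p, hcos, hpc, mul_div_cancel_left₀ _ (by positivity)]
  linear_combination (y * Real.cos ((d + 1 : ℕ) * t)) * hsq

/-! ### The deviation of the extremal polynomials -/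

lemma countable_cos_eq (c : ℝ) : {x : ℝ | Real.cos x = c}.Countable := by
  rcases Set.eq_empty_or_nonempty {x : ℝ | Real.cos x = c} with h | ⟨x₀, hx₀⟩
  · rw [h]; exact Set.countable_empty
  · refine ((Set.countable_range fun k : ℤ => 2 * k * Real.pi + x₀).union
      (Set.countable_range fun k : ℤ => 2 * k * Real.pi - x₀)).mono ?_
    intro x hx
    have hx' : Real.cos x₀ = Real.cos x := hx₀.trans hx.symm
    rw [Real.cos_eq_cos_iff] at hx'
    obtain ⟨k, h | h⟩ := hx'
    · exact Or.inl ⟨k, h.symm⟩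
    · exact Or.inr ⟨k, h.symm⟩

lemma finite_abs_chebyshev_eq_one {n : ℕ} (hn : n ≠ 0) :
    {x : ℝ | |(Polynomial.Chebyshev.T ℝ (n : ℤ)).eval x| = 1}.Finite := by
  have hne : Polynomial.Chebyshev.T ℝ (n : ℤ) ^ 2 - 1 ≠ 0 := by
    intro h
    have h1 := Polynomial.Chebyshev.one_lt_eval_T_real (n := n) (by exact_mod_cast hn)
      (x := 2) (by norm_num)
    have h2 := congrArg (Polynomial.eval 2) h
    simp at h2
    nlinarith
  refine (Polynomial.finite_setOfPred_isRoot hne).subset fun x hx => ?_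
  have hx' : |(Polynomial.Chebyshev.T ℝ (n : ℤ)).eval x| = 1 := hx
  have : (Polynomial.Chebyshev.T ℝ (n : ℤ)).eval x ^ 2 = 1 := by rw [← sq_abs, hx', one_pow]
  simp [Polynomial.IsRoot, this]

/-- The measure over a period of a periodic set does not change under translation. -/
lemma volume_translate_inter_Ioc {S : Set ℝ} (hS : MeasurableSet S)
    (hper : ∀ (x : ℝ) (j : ℤ), x + j * (2 * Real.pi) ∈ S ↔ x ∈ S) (τ : ℝ) :
    volume ({t | t - τ ∈ S} ∩ Set.Ioc 0 (2 * Real.pi)) = volume (S ∩ Set.Ioc 0 (2 * Real.pi)) := by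
  have h2pi : (0 : ℝ) < 2 * Real.pi := by positivity
  have e1 : {t | t - τ ∈ S} ∩ Set.Ioc 0 (2 * Real.pi)
      = (fun t => t + -τ) ⁻¹' (S ∩ Set.Ioc (-τ) (-τ + 2 * Real.pi)) := by
    ext t
    simp only [Set.mem_inter_iff, Set.mem_preimage, Set.mem_Ioc, Set.mem_ofPred_eq, sub_eq_add_neg]
    constructor <;> rintro ⟨h1, h2, h3⟩ <;> exact ⟨h1, by linarith, by linarith⟩
  rw [e1, measure_preimage_add_right]
  have hd := isAddFundamentalDomain_Ioc h2pi (-τ) volume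
  have hd0 := isAddFundamentalDomain_Ioc h2pi 0 volume
  rw [zero_add] at hd0
  refine hd.measure_set_eq hd0 hS ?_
  rintro ⟨g, hg⟩
  obtain ⟨j, rfl⟩ := AddSubgroup.mem_zmultiples_iff.1 hg
  ext x
  have := hper x j
  simpa [AddSubgroup.vadd_def, add_comm] using this

/-- With `Y = y^(1/n) = 1/r²`, the Chebyshev argument lies in `[-1,1]` when `cos x ≥ 1 - 2r² = cos
α`. There `|T| ≤ 1`, with equality at countably many points only, so up to a null set the deviation
set in one period is inside `[α, 2π - α]`, of length `2π - 4 arcsin r`. -/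
theorem deviationMeasure_extremalPoly_le {n : ℕ} (hn : 1 ≤ n) {y : ℝ} (hy : 1 < y) (k : ℕ) :
    deviationMeasure (extremalPoly n y k)
      ≤ 4 * Real.arccos (1 / y ^ (1 / (2 * (n : ℝ)))) := by
  have hy0 : 0 < y := by linarith
  obtain ⟨hr2, -⟩ := one_div_sq_rpow hn hy0
  set r := 1 / y ^ (1 / (2 * (n : ℝ))) with hrdef
  have hr0 : 0 < r := by rw [hrdef]; positivity
  have hr1 : r < 1 := by
    rw [hrdef, div_lt_one (by positivity)]
    exact Real.one_lt_rpow hy (by positivity)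
  set Y := y ^ (1 / (n : ℝ)) with hY
  have hYpos : 0 < Y := Real.rpow_pos_of_pos hy0 _
  have hYr : Y * r ^ 2 = 1 := by rw [← hr2]; field_simp
  set T := Polynomial.Chebyshev.T ℝ (n : ℤ) with hT
  set S : Set ℝ := {x | 1 ≤ |T.eval (Y * Real.cos x - Y + 1)|} with hSdef
  set α := 2 * Real.arcsin r with hα
  have hβ : Real.arcsin r < Real.pi / 2 := by
    rw [← not_le, Real.pi_div_two_le_arcsin]
    linarith
  have hβ0 : 0 < Real.arcsin r := Real.arcsin_pos.2 hr0
  have hcosα : Real.cos α = 1 - 2 * r ^ 2 := by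
    rw [hα, Real.cos_two_mul, Real.cos_sq', Real.sin_arcsin (by linarith) hr1.le]
    ring
  have hcont : Continuous fun x => |T.eval (Y * Real.cos x - Y + 1)| :=
    (T.continuous.comp (by fun_prop : Continuous fun x => Y * Real.cos x - Y + 1)).abs
  have hS : MeasurableSet S := (isClosed_le continuous_const hcont).measurableSet
  have hper : ∀ (x : ℝ) (j : ℤ), x + j * (2 * Real.pi) ∈ S ↔ x ∈ S := by
    intro x j
    simp only [hSdef, Set.mem_ofPred_eq, Real.cos_add_int_mul_two_pi]
  set N : Set ℝ := ⋃ v ∈ {v : ℝ | |T.eval v| = 1}, {x | Real.cos x = (v + Y - 1) / Y} with hN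
  have hNnull : volume N = 0 :=
    ((finite_abs_chebyshev_eq_one (by omega : n ≠ 0)).countable.biUnion
      fun v _ => countable_cos_eq _).measure_zero _
  have hcov : S ∩ Set.Ioc 0 (2 * Real.pi) ⊆ Set.Icc α (2 * Real.pi - α) ∪ N := by
    rintro x ⟨hxS, hx0, hx2⟩
    have hxS' : 1 ≤ |T.eval (Y * Real.cos x - Y + 1)| := hxS
    by_cases hc : Real.cos x ≤ 1 - 2 * r ^ 2
    · left
      rw [← hcosα] at hc
      constructor
      · by_contra hlt
        push Not at hlt
        have := Real.cos_lt_cos_of_nonneg_of_le_pi hx0.le (by linarith) hlt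
        linarith
      · by_contra hlt
        push Not at hlt
        have := Real.cos_lt_cos_of_nonneg_of_le_pi (x := 2 * Real.pi - x) (y := α) (by linarith)
          (by linarith) (by linarith)
        rw [Real.cos_two_pi_sub] at this
        linarith
    · right
      push Not at hc
      have h1 : |Y * Real.cos x - Y + 1| ≤ 1 := by
        rw [abs_le]
        constructor
        · nlinarith
        · nlinarith [Real.cos_le_one x]
      have h2 := le_antisymm (Polynomial.Chebyshev.abs_eval_T_real_le_one (n : ℤ) h1) hxS'
      rw [hN, Set.mem_iUnion₂]
      refine ⟨_, h2, ?_⟩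
      simp only [Set.mem_ofPred_eq]
      field_simp
      ring
  have hset : {t : ℝ | t ∈ Set.Icc 0 (2 * Real.pi) ∧ 1 ≤ |extremalPoly n y k t|}
      = {t | t - Real.pi * k / n ∈ S} ∩ Set.Icc 0 (2 * Real.pi) := by
    ext t
    have : |extremalPoly n y k t|
        = |T.eval (Y * Real.cos (t - Real.pi * k / n) - Y + 1)| := by
      unfold extremalPoly
      rw [abs_mul, abs_pow, abs_neg, abs_one, one_pow, one_mul]
    simp only [Set.mem_inter_iff, Set.mem_ofPred_eq, hSdef, this]
    exact and_comm
  unfold deviationMeasure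
  rw [measureReal_def, hset]
  have hae : volume ({t | t - Real.pi * k / n ∈ S} ∩ Set.Icc 0 (2 * Real.pi))
      = volume ({t | t - Real.pi * k / n ∈ S} ∩ Set.Ioc 0 (2 * Real.pi)) :=
    measure_congr ((ae_eq_refl _).inter Ioc_ae_eq_Icc.symm)
  rw [hae, volume_translate_inter_Ioc hS hper]
  have hle : volume (S ∩ Set.Ioc 0 (2 * Real.pi)) ≤ ENNReal.ofReal (2 * Real.pi - α - α) := by
    refine (measure_mono hcov).trans ((measure_union_le _ _).trans ?_)
    rw [hNnull, add_zero, Real.volume_Icc]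
  refine (ENNReal.toReal_mono ENNReal.ofReal_ne_top hle).trans ?_
  rw [ENNReal.toReal_ofReal (by linarith), Real.arccos]
  linarith

theorem leastDeviation_eq {n : ℕ} (hn : 1 ≤ n) {y : ℝ} (hy : 1 < y) :
    leastDeviation n y = 4 * Real.arccos (1 / y ^ (1 / (2 * (n : ℝ)))) := by
  refine IsLeast.csInf_eq ⟨⟨_, extremalPoly_mem hn hy 0, ?_⟩, ?_⟩
  · exact le_antisymm (deviationMeasure_extremalPoly_le hn hy 0)
      (arccos_le_deviationMeasure hn hy (extremalPoly_mem hn hy 0))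
  · rintro _ ⟨f, hf, rfl⟩
    exact arccos_le_deviationMeasure hn hy hf

theorem theorem1 (n : ℕ) (hn : 1 ≤ n) (y : ℝ) (hy : 1 < y) :
    leastDeviation n y = 4 * Real.arccos (1 / y ^ (1 / (2 * (n : ℝ)))) ∧
    (∀ k : ℕ, k < 2 * n → IsLeastDeviating n y (extremalPoly n y k)) ∧
    (∀ f : ℝ → ℝ, IsLeastDeviating n y f → ∃ k : ℕ, k < 2 * n ∧ f = extremalPoly n y k) := by
  refine ⟨leastDeviation_eq hn hy, fun k _ => ⟨extremalPoly_mem hn hy k, ?_⟩,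
    fun f hf => ?_⟩
  · rw [leastDeviation_eq hn hy]
    exact le_antisymm (deviationMeasure_extremalPoly_le hn hy k)
      (arccos_le_deviationMeasure hn hy (extremalPoly_mem hn hy k))
  · exact eq_extremalPoly_of_deviationMeasure hn hy hf.1
      (hf.2.trans (leastDeviation_eq hn hy))
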